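/- A set $K\subseteq\mathbb R^N$ is called $p$-convex ($0<p<1$) if $K=-K$ and $\lambda^{1/p}x+(1-\lambda)^{1/p}y\in K$ for all $x,y\in K$ and $0<\lambda<1$; a $p$-convex body is a compact $p$-convex set with non-empty interior. Let $G$ be a standard Gaussian random variable and let $W$, independent of $G$, be uniform on the interval $\left[\sqrt{3/7},\,2\sqrt{3/7}\right]$. **Theorem.** There are universal constants $c,C>0$ such that the following holds for every integer $n\ge 1$. Let $N=n+\lceil n^{5/2}\log^2 n\rceil$. There are a $\frac12$-convex body $K\subseteq\mathbb R^N$ and a subspace $E\subseteq\mathbb R^N$ with $\dim E=n$ such that, if $X$ is distributed uniformly in $K$, then for every $\theta\in S^{N-1}\cap E$: 1. for every $t\in\mathbb R$ there is $s\in\mathbb R$ with $|s-1|\le C n^{-\frac12+\frac1{100}}$ and $$\Big|\,\mathbb P\big(|\theta\cdot \mathrm{Proj}_E X|\le t\big)-\mathbb P\big(|G|\,W\le ts\big)\Big|\le \frac{C}{\sqrt n};$$ 2. the Kolmogorov distance, the ($L^1$-)Wasserstein distance and the Lévy–Prokhorov distance between the law of $\theta\cdot \mathrm{Proj}_E X$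 and any Gaussian law $N(m,v)$, $m\in\mathbb R$, $v\ge 0$, are all at least $c$. Consequently the central limit theorem for convex bodies does not extend to $\frac12$-convex bodies: there is no sequence $\varepsilon_n\to 0$ such that for all $n\ge1$ and $M$, every $\frac12$-convex body $K\subseteq\mathbb R^M$ and every $n$-dimensional subspace $E\subseteq\mathbb R^M$ there is some $\theta\in S^{M-1}\cap E$ for which the law of $\theta\cdot\mathrm{Proj}_E X$, $X$ uniform in $K$, is within Kolmogorov distance $\varepsilon_n$ of some Gaussian law. -/

import Mathlib

open MeasureTheory ProbabilityTheory Filter Topology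
open scoped ENNReal NNReal Pointwise

/-- A set `K` in a real vector space is `p`-convex if `K = -K` and
`l ^ (1/p) x + (1 - l) ^ (1/p) y ∈ K` for all `x, y ∈ K` and `0 < l < 1`. -/
def IsPConvex {V : Type*} [AddCommGroup V] [Module ℝ V] (p : ℝ) (K : Set V) : Prop :=
  K = -K ∧ ∀ x ∈ K, ∀ y ∈ K, ∀ l : ℝ, 0 < l → l < 1 →
    l ^ (1 / p) • x + (1 - l) ^ (1 / p) • y ∈ K

/-- A `p`-convex body in `ℝ^N`: a compact `p`-convex set with non-empty interior. -/
structure IsPConvexBody {N : ℕ} (p : ℝ) (K : Set (EuclideanSpace ℝ (Fin N))) : Prop where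
  isPConvex : IsPConvex p K
  isCompact : IsCompact K
  nonempty_interior : (interior K).Nonempty

/-- The uniform probability distribution on `K`: Lebesgue measure restricted to `K`, divided by
the volume of `K`. -/
noncomputable def uniformLaw {V : Type*} [MeasureSpace V] (K : Set V) : Measure V :=
  cond volume K

/-- The law of the real random variable `θ · Proj_E X`, where `X` is uniform on `K` and `Proj_E` is
the orthogonal projection onto `E`. -/
noncomputable def marginalLaw {N : ℕ} (K : Set (EuclideanSpace ℝ (Fin N)))
    (E : Submodule ℝ (EuclideanSpace ℝ (Fin N))) (θ : EuclideanSpace ℝ (Fin N)) : Measure ℝ :=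
  (uniformLaw K).map (fun x => inner ℝ θ (E.starProjection x))

/-- The law of `|G| W`, where `G` is a standard Gaussian, `W` is uniform on the interval
`[√(3/7), 2√(3/7)]`, and `G` and `W` are independent. -/
noncomputable def absGaussianMulUniformLaw : Measure ℝ :=
  ((gaussianReal 0 1).prod (uniformLaw (Set.Icc (√(3 / 7)) (2 * √(3 / 7))))).map
    (fun q : ℝ × ℝ => |q.1| * q.2)

/-- The Kolmogorov distance of two probability measures on `ℝ`: the supremum distance of their
distribution functions. -/
noncomputable def kolmogorovDist (μ ν : Measure ℝ) : ℝ :=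
  ⨆ t : ℝ, |μ.real (Set.Iic t) - ν.real (Set.Iic t)|

/-- The (`L¹`-)Wasserstein distance of two probability measures on `ℝ`: the infimum of
`∫ |x - y| dπ(x, y)` over all couplings `π`. -/
noncomputable def wassersteinDist (μ ν : Measure ℝ) : ℝ≥0∞ :=
  ⨅ π ∈ {π : Measure (ℝ × ℝ) | π.map Prod.fst = μ ∧ π.map Prod.snd = ν},
    ∫⁻ q, edist q.1 q.2 ∂π

/-- The dimension `N = n + n^(5/2) log² n`, the second summand rounded up to an integer. -/
noncomputable def ambientDim (n : ℕ) : ℕ :=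
  n + ⌈(n : ℝ) ^ (5 / 2 : ℝ) * Real.log n ^ 2⌉₊

/-! The body is a body of revolution about an n-dimensional axis E, with a ball of radius r(|x|)
over each x in E with |x| ≤ R. By Fubini, the projection to E of its uniform law has density
proportional to r^M on the R-ball, where M is the codimension. So if r is the M-th root of a radial
density, the projection has that density, truncated. The density chosen is the mixture of N(0, w²
Id) with w uniform in [a, 2a]; in every direction its marginal is exactly the law of G W. The
truncation at R² = 32a²n costs at most e^(-n), so item 1 holds with s = 1.

For p = 1/2 the weights satisfy l² + (1-l)² < 1, and this slack makes the body 1/2-convex although r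
need not be concave. As w ≥ a, the logarithm of the density falls at rate at most 1/(2a²) in ρ², and
that of r at rate at most 1/(2a²M). This is slow enough on [0, R] as soon as M ≥ 48n
(`profile_half_convex`), which the stated codimension exceeds for n ≥ 16.

Non-Gaussianity is a closure argument. Every Gaussian characteristic function satisfies |φ(t)| =
|φ(1)|^(t²), and weak limits inherit this. A symmetric law with this property is a centred Gaussian,
so a symmetric law that is not Gaussian has positive Lévy distance to the set of all Gaussians
(`exists_forall_not_levyClose_gaussianReal`). This gap passes to the Kolmogorov, Wasserstein and
Lévy–Prokhorov distances. The finitely many small n are handled by the Euclidean ball. -/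

/-! ### Lévy closeness and its relation to the three distances -/

/-- The distribution functions of `μ` and `ν` are within Lévy distance `δ` of each other. -/
def LevyClose (δ : ℝ) (μ ν : Measure ℝ) : Prop :=
  ∀ t, μ.real (Set.Iic t) ≤ ν.real (Set.Iic (t + δ)) + δ ∧
    ν.real (Set.Iic t) ≤ μ.real (Set.Iic (t + δ)) + δ

lemma LevyClose.mono {δ δ' : ℝ} {μ ν : Measure ℝ} [IsFiniteMeasure μ] [IsFiniteMeasure ν]
    (h : LevyClose δ μ ν) (hδ : δ ≤ δ') : LevyClose δ' μ ν := fun t =>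
  ⟨(h t).1.trans (add_le_add (measureReal_mono (Set.Iic_subset_Iic.2 (by linarith))) hδ),
    (h t).2.trans (add_le_add (measureReal_mono (Set.Iic_subset_Iic.2 (by linarith))) hδ)⟩

lemma LevyClose.of_real_Iic_close {δ ε : ℝ} {μ μ' ν : Measure ℝ} (h : LevyClose δ μ ν)
    [IsFiniteMeasure μ] [IsFiniteMeasure μ'] [IsFiniteMeasure ν] (hε : 0 ≤ ε)
    (hμ : ∀ t, |μ.real (Set.Iic t) - μ'.real (Set.Iic t)| ≤ ε) : LevyClose (δ + ε) μ' ν := by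
  intro t
  have h1 := abs_le.1 (hμ t)
  have h2 := abs_le.1 (hμ (t + δ))
  have h3 := h t
  have h4 : ν.real (Set.Iic (t + δ)) ≤ ν.real (Set.Iic (t + (δ + ε))) :=
    measureReal_mono (Set.Iic_subset_Iic.2 (by linarith))
  have h5 : μ'.real (Set.Iic (t + δ)) ≤ μ'.real (Set.Iic (t + (δ + ε))) :=
    measureReal_mono (Set.Iic_subset_Iic.2 (by linarith))
  constructor <;> linarith

lemma bddAbove_range_abs_real_Iic_sub (μ ν : Measure ℝ) [IsProbabilityMeasure μ]
    [IsProbabilityMeasure ν] :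
    BddAbove (Set.range fun t : ℝ => |μ.real (Set.Iic t) - ν.real (Set.Iic t)|) := by
  refine ⟨1, ?_⟩
  rintro _ ⟨t, rfl⟩
  have h1 := measureReal_le_one (μ := μ) (s := Set.Iic t)
  have h2 := measureReal_le_one (μ := ν) (s := Set.Iic t)
  have h3 := measureReal_nonneg (μ := μ) (s := Set.Iic t)
  have h4 := measureReal_nonneg (μ := ν) (s := Set.Iic t)
  exact abs_le.2 ⟨by linarith, by linarith⟩

lemma levyClose_of_kolmogorovDist_lt {δ : ℝ} {μ ν : Measure ℝ} [IsProbabilityMeasure μ]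
    [IsProbabilityMeasure ν] (h : kolmogorovDist μ ν < δ) : LevyClose δ μ ν := by
  have h0 : ∀ t, |μ.real (Set.Iic t) - ν.real (Set.Iic t)| ≤ δ := fun t =>
    (le_ciSup (bddAbove_range_abs_real_Iic_sub μ ν) t).trans h.le
  have hδ : 0 ≤ δ := (abs_nonneg _).trans (h0 0)
  intro t
  have h1 := abs_le.1 (h0 t)
  have h4 : ν.real (Set.Iic t) ≤ ν.real (Set.Iic (t + δ)) :=
    measureReal_mono (Set.Iic_subset_Iic.2 (by linarith))
  have h5 : μ.real (Set.Iic t) ≤ μ.real (Set.Iic (t + δ)) :=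
    measureReal_mono (Set.Iic_subset_Iic.2 (by linarith))
  constructor <;> linarith

lemma real_le_add_of_le_add {μ ν : Measure ℝ} [IsFiniteMeasure μ] [IsFiniteMeasure ν]
    {A B : Set ℝ} {δ : ℝ} (hδ : 0 ≤ δ) (h : μ A ≤ ν B + ENNReal.ofReal δ) :
    μ.real A ≤ ν.real B + δ := by
  have := ENNReal.toReal_mono (by finiteness) h
  rwa [ENNReal.toReal_add (by finiteness) (by finiteness), ENNReal.toReal_ofReal hδ] at this

lemma levyClose_of_levyProkhorovEDist_lt {δ : ℝ} (hδ : 0 ≤ δ) {μ ν : Measure ℝ}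
    [IsProbabilityMeasure μ] [IsProbabilityMeasure ν]
    (h : levyProkhorovEDist μ ν < ENNReal.ofReal δ) : LevyClose δ μ ν := by
  have hsub : ∀ t : ℝ, Metric.thickening δ (Set.Iic t) ⊆ Set.Iic (t + δ) := by
    intro t x hx
    obtain ⟨y, hy, hxy⟩ := Metric.mem_thickening_iff.1 hx
    rw [Real.dist_eq] at hxy
    have := (abs_lt.1 hxy).2
    simp only [Set.mem_Iic] at hy ⊢
    linarith
  intro t
  have h1 := left_measure_le_of_levyProkhorovEDist_lt h (measurableSet_Iic (a := t))
  have h2 := right_measure_le_of_levyProkhorovEDist_lt h (measurableSet_Iic (a := t))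
  rw [ENNReal.toReal_ofReal hδ] at h1 h2
  exact ⟨real_le_add_of_le_add hδ (h1.trans (by gcongr; exact hsub t)),
    real_le_add_of_le_add hδ (h2.trans (by gcongr; exact hsub t))⟩

/-- Markov's inequality at threshold δ: transport cost at most δ² means that f and g differ by δ or
more with mass at most δ. -/
lemma measure_Iic_le_of_lintegral_edist_le {δ : ℝ} (hδ : 0 < δ) (π : Measure (ℝ × ℝ))
    (f g : ℝ × ℝ → ℝ) (hf : Measurable f) (hg : Measurable g)
    (h : ∫⁻ q, edist (f q) (g q) ∂π ≤ ENNReal.ofReal (δ ^ 2)) (t : ℝ) :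
    π.map f (Set.Iic t) ≤ π.map g (Set.Iic (t + δ)) + ENNReal.ofReal δ := by
  rw [Measure.map_apply hf measurableSet_Iic, Measure.map_apply hg measurableSet_Iic]
  have hm : π {q | ENNReal.ofReal δ ≤ edist (f q) (g q)} ≤ ENNReal.ofReal δ := by
    have := mul_meas_ge_le_lintegral (μ := π) (f := fun q => edist (f q) (g q))
      (by fun_prop) (ENNReal.ofReal δ)
    have h2 := this.trans h
    rw [sq, ENNReal.ofReal_mul hδ.le] at h2
    exact (ENNReal.mul_le_mul_iff_right (by simpa using hδ) (by simp)).1 h2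
  refine (measure_mono ?_).trans ((measure_union_le _ _).trans (add_le_add_right hm _))
  intro q hq
  by_cases hq' : g q ≤ t + δ
  · exact Or.inl hq'
  · right
    simp only [Set.mem_preimage, Set.mem_Iic, Set.mem_ofPred_eq] at hq ⊢
    rw [edist_dist, Real.dist_eq]
    apply ENNReal.ofReal_le_ofReal
    rw [abs_sub_comm]
    exact le_trans (by linarith) (le_abs_self _)

lemma levyClose_of_wassersteinDist_lt {δ : ℝ} (hδ : 0 < δ) {μ ν : Measure ℝ}
    [IsProbabilityMeasure μ] [IsProbabilityMeasure ν]
    (h : wassersteinDist μ ν < ENNReal.ofReal (δ ^ 2)) : LevyClose δ μ ν := by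
  obtain ⟨π, hπ⟩ := iInf_lt_iff.1 h
  obtain ⟨⟨h1, h2⟩, hlt⟩ := iInf_lt_iff.1 hπ
  intro t
  have e1 := measure_Iic_le_of_lintegral_edist_le hδ π Prod.fst Prod.snd measurable_fst
    measurable_snd hlt.le t
  have e2 := measure_Iic_le_of_lintegral_edist_le hδ π Prod.snd Prod.fst measurable_snd
    measurable_fst (by simpa only [edist_comm] using hlt.le) t
  rw [h1, h2] at e1 e2
  exact ⟨real_le_add_of_le_add hδ.le e1, real_le_add_of_le_add hδ.le e2⟩

/-! ### From Lévy closeness to weak convergence -/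

/-- The value at x is squeezed between those of the distribution function of μ at x ± δ, up to δ.
Having no atom at x makes both bounds converge. -/
lemma tendsto_real_Iic_of_levyClose {μ : Measure ℝ} [IsProbabilityMeasure μ] {ν : ℕ → Measure ℝ}
    [∀ k, IsProbabilityMeasure (ν k)] {δ : ℕ → ℝ} (hδ : Tendsto δ atTop (𝓝 0))
    (h : ∀ k, LevyClose (δ k) μ (ν k)) {x : ℝ} (hx : μ {x} = 0) :
    Tendsto (fun k => (ν k).real (Set.Iic x)) atTop (𝓝 (μ.real (Set.Iic x))) := by
  have hcont : ContinuousAt (fun y => μ.real (Set.Iic y)) x := by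
    have hl : Function.leftLim (cdf μ) x = cdf μ x := by
      have h1 := (cdf μ).measure_singleton x
      rw [measure_cdf, hx] at h1
      have h2 := ENNReal.ofReal_eq_zero.1 h1.symm
      exact le_antisymm ((monotone_cdf μ).leftLim_le le_rfl) (by linarith)
    have h3 : ContinuousAt (cdf μ) x := by
      rw [(monotone_cdf μ).continuousAt_iff_leftLim_eq_rightLim, hl]
      exact ((cdf μ).rightLim_eq x).symm
    have h4 : (fun y => μ.real (Set.Iic y)) = cdf μ := by
      ext y; rw [cdf_eq_real]
    rw [h4]; exact h3
  have l1 : Tendsto (fun k => μ.real (Set.Iic (x + δ k)) + δ k) atTop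
      (𝓝 (μ.real (Set.Iic x))) := by
    have : Tendsto (fun k => x + δ k) atTop (𝓝 x) := by simpa using hδ.const_add x
    simpa using (hcont.tendsto.comp this).add hδ
  have l2 : Tendsto (fun k => μ.real (Set.Iic (x - δ k)) - δ k) atTop
      (𝓝 (μ.real (Set.Iic x))) := by
    have : Tendsto (fun k => x - δ k) atTop (𝓝 x) := by simpa using hδ.const_sub x
    simpa using (hcont.tendsto.comp this).sub hδ
  refine tendsto_of_tendsto_of_tendsto_of_le_of_le l2 l1 (fun k => ?_) (fun k => (h k x).2)
  have := (h k (x - δ k)).1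
  simp only [sub_add_cancel] at this
  simpa using this

/-- Half-open intervals whose endpoints are not atoms of μ form a π-system containing arbitrarily
small neighbourhoods of each point, because the atoms are countable. -/
lemma tendsto_of_tendsto_real_Iic {μ : ProbabilityMeasure ℝ} {ν : ℕ → ProbabilityMeasure ℝ}
    (h : ∀ x, (μ : Measure ℝ) {x} = 0 → Tendsto (fun k => (ν k : Measure ℝ).real (Set.Iic x)) atTop
      (𝓝 ((μ : Measure ℝ).real (Set.Iic x)))) : Tendsto ν atTop (𝓝 μ) := by
  have hcount : {x : ℝ | 0 < (μ : Measure ℝ) {x}}.Countable := by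
    have := Measure.countable_meas_level_set_pos (μ := (μ : Measure ℝ)) (g := fun x : ℝ => x)
      measurable_id
    simpa using this
  have hdense : Dense {x : ℝ | (μ : Measure ℝ) {x} = 0} := by
    have := hcount.dense_compl ℝ
    convert this using 1
    ext x; simp
  let S : Set (Set ℝ) := {s | ∃ a b, (μ : Measure ℝ) {a} = 0 ∧ (μ : Measure ℝ) {b} = 0 ∧
    s = Set.Ioc a b}
  refine IsPiSystem.tendsto_probabilityMeasure_of_tendsto_of_mem (S := S) ?_ ?_ ?_ ?_
  · rintro _ ⟨a, b, ha, hb, rfl⟩ _ ⟨a', b', ha', hb', rfl⟩ -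
    refine ⟨max a a', min b b', ?_, ?_, Set.Ioc_inter_Ioc⟩
    · rcases max_choice a a' with h | h <;> rwa [h]
    · rcases min_choice b b' with h | h <;> rwa [h]
  · rintro _ ⟨a, b, -, -, rfl⟩
    exact measurableSet_Ioc
  · intro u hu x hx
    obtain ⟨l, r, ⟨hl, hr⟩, hlr⟩ := mem_nhds_iff_exists_Ioo_subset.1 (hu.mem_nhds hx)
    obtain ⟨a, ha, hla, hax⟩ := hdense.exists_between hl
    obtain ⟨b, hb, hxb, hbr⟩ := hdense.exists_between hr
    exact ⟨_, ⟨a, b, ha, hb, rfl⟩, Ioc_mem_nhds hax hxb,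
      fun y hy => hlr ⟨hla.trans hy.1, hy.2.trans_lt hbr⟩⟩
  · rintro _ ⟨a, b, ha, hb, rfl⟩
    -- The maximum covers b < a as well, where the interval is empty.
    have key : ∀ ρ : ProbabilityMeasure ℝ, ((ρ (Set.Ioc a b) : ℝ≥0) : ℝ) =
        (ρ : Measure ℝ).real (Set.Iic (max a b)) - (ρ : Measure ℝ).real (Set.Iic a) := by
      intro ρ
      rw [← measureReal_sdiff (Set.Iic_subset_Iic.2 (le_max_left a b)) measurableSet_Iic]
      have : Set.Iic (max a b) \ Set.Iic a = Set.Ioc a b := by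
        ext y; simp only [Set.mem_sdiff, Set.mem_Iic, Set.mem_Ioc, le_max_iff]; grind
      rw [this]; rfl
    rw [← NNReal.tendsto_coe]
    simp only [key]
    refine (h _ ?_).sub (h _ ha)
    rcases max_choice a b with h | h <;> rwa [h]

/-! ### Positive distance from all Gaussians -/

/-- The characteristic function of a real measure symmetric under `x ↦ -x` is real. -/
lemma charFun_im_eq_zero_of_map_neg {μ : Measure ℝ} (hμ : μ.map (fun x => -x) = μ) (t : ℝ) :
    (charFun μ t).im = 0 := by
  have h1 : charFun μ (-t) = charFun μ t := by
    conv_rhs => rw [← hμ]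
    rw [show (fun x : ℝ => -x) = fun x => (-1 : ℝ) * x by ext x; ring, charFun_map_mul]
    simp
  rw [charFun_neg] at h1
  exact Complex.conj_eq_iff_im.1 h1

/-- Taking the modulus removes the mean. The form q^(t²) eliminates the variance through q = |φ(1)|,
leaving a relation closed under pointwise limits. -/
lemma norm_charFun_gaussianReal (m : ℝ) (v : ℝ≥0) (t : ℝ) :
    ‖charFun (gaussianReal m v) t‖ = Real.exp (-(v / 2)) ^ (t ^ 2) := by
  rw [charFun_gaussianReal, Complex.norm_exp, ← Real.exp_mul]
  congr 1
  have : (t * m * Complex.I - v * t ^ 2 / 2 : ℂ).re = -(v * t ^ 2 / 2 : ℝ) := by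
    have h2 : ((v : ℂ) * t ^ 2 / 2 : ℂ) = ((v * t ^ 2 / 2 : ℝ) : ℂ) := by push_cast; rfl
    rw [h2, Complex.sub_re, Complex.ofReal_re]
    simp
  rw [this]
  ring

lemma eq_gaussianReal_of_norm_charFun {μ : Measure ℝ} [IsProbabilityMeasure μ]
    (hμ : μ.map (fun x => -x) = μ)
    (h : ∀ t : ℝ, ‖charFun μ t‖ = ‖charFun μ 1‖ ^ (t ^ 2)) : ∃ v : ℝ≥0, μ = gaussianReal 0 v := by
  have hc : Continuous (fun t => charFun μ t) := continuous_charFun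
  -- Otherwise φ would vanish off 0, against continuity and φ(0) = 1.
  have hp : 0 < ‖charFun μ 1‖ := by
    refine (norm_nonneg _).lt_of_ne fun h0 => ?_
    have hz : ∀ t : ℝ, t ≠ 0 → ‖charFun μ t‖ = 0 := fun t ht => by
      rw [h t, ← h0, Real.zero_rpow (by positivity)]
    have h1 : Tendsto (fun t => ‖charFun μ t‖) (𝓝[≠] 0) (𝓝 ‖charFun μ 0‖) :=
      (hc.norm.tendsto 0).mono_left nhdsWithin_le_nhds
    have h2 : Tendsto (fun t => ‖charFun μ t‖) (𝓝[≠] 0) (𝓝 0) :=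
      tendsto_const_nhds.congr' (by
        filter_upwards [self_mem_nhdsWithin] with t ht using (hz t ht).symm)
    have := tendsto_nhds_unique h1 h2
    simp at this
  have hle : ‖charFun μ 1‖ ≤ 1 := norm_charFun_le_one 1
  have hne : ∀ t, (charFun μ t).re ≠ 0 := by
    intro t h0
    have h1 : ‖charFun μ t‖ = 0 := by
      rw [norm_eq_zero]; exact Complex.ext h0 (charFun_im_eq_zero_of_map_neg hμ t)
    rw [h t] at h1
    exact (Real.rpow_pos_of_pos hp _).ne' h1
  -- By symmetry φ is real; being continuous, nowhere zero and 1 at 0, it stays positive, so it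
  -- equals its modulus.
  have hpos : ∀ t, 0 < (charFun μ t).re := by
    intro t
    by_contra! hneg
    have hcr : Continuous (fun t => (charFun μ t).re) := Complex.continuous_re.comp hc
    have : (0 : ℝ) ∈ Set.range (fun t => (charFun μ t).re) :=
      mem_range_of_exists_le_of_exists_ge hcr ⟨t, hneg⟩ ⟨0, by simp⟩
    obtain ⟨s, hs⟩ := this
    exact hne s hs
  obtain ⟨v, hv⟩ : ∃ v : ℝ≥0, (v : ℝ) = -2 * Real.log ‖charFun μ 1‖ :=
    ⟨⟨-2 * Real.log ‖charFun μ 1‖, by nlinarith [Real.log_nonpos hp.le hle]⟩, rfl⟩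
  refine ⟨v, ?_⟩
  refine Measure.ext_of_charFun ?_
  ext t
  have e1 : charFun μ t = ((‖charFun μ 1‖ ^ (t ^ 2) : ℝ) : ℂ) := by
    rw [← h t]
    have him := charFun_im_eq_zero_of_map_neg hμ t
    have : charFun μ t = ((charFun μ t).re : ℂ) := Complex.ext rfl (by simpa using him)
    rw [this, Complex.norm_real, Real.norm_of_nonneg (hpos t).le]
  rw [e1, charFun_gaussianReal, Real.rpow_def_of_pos hp, Complex.ofReal_exp]
  congr 1
  have hv' : (v : ℂ) = -2 * (Real.log ‖charFun μ 1‖ : ℝ) := by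
    rw [hv]; push_cast; rfl
  rw [hv']
  push_cast
  ring

/-- Otherwise some Gaussians, with arbitrary means and variances, converge weakly to μ, and the
modulus relation passes to μ. No tightness of the parameters is needed. -/
lemma exists_forall_not_levyClose_gaussianReal {μ : Measure ℝ} [IsProbabilityMeasure μ]
    (hμ : μ.map (fun x => -x) = μ) (hG : ∀ v : ℝ≥0, μ ≠ gaussianReal 0 v) :
    ∃ c : ℝ, 0 < c ∧ ∀ (m : ℝ) (v : ℝ≥0), ¬ LevyClose c μ (gaussianReal m v) := by
  by_contra! hcon
  choose m v hmv using fun k : ℕ => hcon (1 / ((k : ℝ) + 1)) (by positivity)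
  let μ' : ProbabilityMeasure ℝ := ⟨μ, inferInstance⟩
  let ν : ℕ → ProbabilityMeasure ℝ := fun k => ⟨gaussianReal (m k) (v k), inferInstance⟩
  have hlim : Tendsto ν atTop (𝓝 μ') := tendsto_of_tendsto_real_Iic fun x hx =>
    tendsto_real_Iic_of_levyClose tendsto_one_div_add_atTop_nhds_zero_nat hmv hx
  have hchar : ∀ t : ℝ, Tendsto (fun k => ‖charFun (gaussianReal (m k) (v k)) t‖) atTop
      (𝓝 ‖charFun μ t‖) := fun t =>
    (ProbabilityMeasure.tendsto_iff_tendsto_charFun.1 hlim t).norm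
  obtain ⟨w, hw⟩ := eq_gaussianReal_of_norm_charFun hμ fun t => by
    refine tendsto_nhds_unique (hchar t) ?_
    -- Since t² ≥ 0, the power is continuous even if the limiting base is 0.
    have h1 := (hchar 1).rpow_const (p := t ^ 2) (Or.inr (sq_nonneg t))
    refine h1.congr fun k => ?_
    simp [norm_charFun_gaussianReal]
  exact hG w hw

/-- The square is forced by the Wasserstein distance, where Markov's inequality loses it; for the
other two, c² ≤ c suffices. -/
lemma gaussianReal_gap_of_not_levyClose {μ : Measure ℝ} [IsProbabilityMeasure μ] {c : ℝ}
    (hc : 0 < c) (hc1 : c ≤ 1) {m : ℝ} {v : ℝ≥0} (h : ¬ LevyClose c μ (gaussianReal m v)) :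
    c ^ 2 ≤ kolmogorovDist μ (gaussianReal m v) ∧
      ENNReal.ofReal (c ^ 2) ≤ wassersteinDist μ (gaussianReal m v) ∧
      ENNReal.ofReal (c ^ 2) ≤ levyProkhorovEDist μ (gaussianReal m v) := by
  have hcc : c ^ 2 ≤ c := by nlinarith
  refine ⟨?_, ?_, ?_⟩ <;> by_contra! hlt
  · exact h (levyClose_of_kolmogorovDist_lt (hlt.trans_le hcc))
  · exact h (levyClose_of_wassersteinDist_lt hc hlt)
  · exact h (levyClose_of_levyProkhorovEDist_lt hc.le
      (hlt.trans_le (ENNReal.ofReal_le_ofReal hcc)))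

/-! ### Radial profiles of Gaussians and of their scale mixture -/

/-- The radial profile of the density of the Gaussian law `N(0, w² Id)` in dimension `d`. -/
noncomputable def gaussProfile (d : ℕ) (w ρ : ℝ) : ℝ :=
  (2 * Real.pi * w ^ 2) ^ (-(d / 2) : ℝ) * Real.exp (-(1 / (2 * w ^ 2)) * ρ ^ 2)

/-- The centred Gaussian measure `N(0, w² Id)` on a Euclidean space. -/
noncomputable def gaussMeasure (V : Type*) [NormedAddCommGroup V] [InnerProductSpace ℝ V]
    [MeasurableSpace V] [BorelSpace V] [FiniteDimensional ℝ V] (w : ℝ) : Measure V :=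
  volume.withDensity fun x => ENNReal.ofReal (gaussProfile (Module.finrank ℝ V) w ‖x‖)

/-- The radial profile of a mixture of the Gaussian laws `N(0, w² Id)`, `w` being uniform in
`[a, 2a]`. -/
noncomputable def mixProfile (a : ℝ) (d : ℕ) (ρ : ℝ) : ℝ :=
  ∫ w, gaussProfile d w ρ ∂(uniformLaw (Set.Icc a (2 * a)))

/-- The mixture of the Gaussian measures `N(0, w² Id)`, `w` being uniform in `[a, 2a]`. -/
noncomputable def mixMeasure (V : Type*) [NormedAddCommGroup V] [InnerProductSpace ℝ V]
    [MeasurableSpace V] [BorelSpace V] [FiniteDimensional ℝ V] (a : ℝ) : Measure V :=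
  volume.withDensity fun x => ENNReal.ofReal (mixProfile a (Module.finrank ℝ V) ‖x‖)

/-- The law of `G W`, with `G` standard Gaussian and `W` uniform in `[a, 2a]`, independent. -/
noncomputable def gaussianMulUniform (a : ℝ) : Measure ℝ :=
  ((gaussianReal 0 1).prod (uniformLaw (Set.Icc a (2 * a)))).map (fun q : ℝ × ℝ => q.1 * q.2)

section uniform
variable {a : ℝ}

lemma isProbabilityMeasure_uniformLaw_Icc (ha : 0 < a) :
    IsProbabilityMeasure (uniformLaw (Set.Icc a (2 * a))) := by
  unfold uniformLaw
  refine cond_isProbabilityMeasure_of_finite ?_ ?_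
  · rw [Real.volume_Icc]; simp; linarith
  · rw [Real.volume_Icc]; simp

lemma ae_mem_uniformLaw_Icc : ∀ᵐ w ∂(uniformLaw (Set.Icc a (2 * a))), w ∈ Set.Icc a (2 * a) :=
  ae_cond_mem measurableSet_Icc

lemma ae_pos_uniformLaw_Icc (ha : 0 < a) : ∀ᵐ w ∂(uniformLaw (Set.Icc a (2 * a))), 0 < w := by
  filter_upwards [ae_mem_uniformLaw_Icc] with w hw using ha.trans_le hw.1

end uniform

lemma gaussProfile_pos (d : ℕ) {w : ℝ} (hw : 0 < w) (ρ : ℝ) : 0 < gaussProfile d w ρ := by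
  unfold gaussProfile; positivity

@[fun_prop]
lemma measurable_gaussProfile (d : ℕ) :
    Measurable (fun q : ℝ × ℝ => gaussProfile d q.1 q.2) := by
  unfold gaussProfile; fun_prop

lemma continuous_gaussProfile (d : ℕ) (w : ℝ) : Continuous (gaussProfile d w) := by
  unfold gaussProfile; fun_prop

lemma gaussProfile_le (d : ℕ) {a w : ℝ} (ha : 0 < a) (hw : a ≤ w) (ρ : ℝ) :
    gaussProfile d w ρ ≤ (2 * Real.pi * a ^ 2) ^ (-(d / 2) : ℝ) := by
  unfold gaussProfile
  have h1 : (2 * Real.pi * w ^ 2) ^ (-(d / 2) : ℝ) ≤ (2 * Real.pi * a ^ 2) ^ (-(d / 2) : ℝ) := by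
    apply Real.rpow_le_rpow_of_nonpos (by positivity) (by gcongr)
    simp; positivity
  have h2 : Real.exp (-(1 / (2 * w ^ 2)) * ρ ^ 2) ≤ 1 := by
    rw [Real.exp_le_one_iff]
    have : 0 ≤ 1 / (2 * w ^ 2) * ρ ^ 2 := by positivity
    linarith
  calc _ ≤ (2 * Real.pi * a ^ 2) ^ (-(d / 2) : ℝ) * 1 := by gcongr
    _ = _ := mul_one _

/-- The decay rate 1/(2w²) in ρ² is at most 1/(2a²). The bound is uniform in w ≥ a, so it survives
averaging over w. -/
lemma gaussProfile_mul_exp_le (d : ℕ) {a w : ℝ} (ha : 0 < a) (hw : a ≤ w) {ρ σ : ℝ} (hρ : 0 ≤ ρ)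
    (h : ρ ≤ σ) :
    gaussProfile d w ρ * Real.exp (-(σ ^ 2 - ρ ^ 2) / (2 * a ^ 2)) ≤ gaussProfile d w σ := by
  unfold gaussProfile
  have hw0 : 0 < w := ha.trans_le hw
  rw [mul_assoc, ← Real.exp_add]
  gcongr
  have h1 : 1 / (2 * w ^ 2) ≤ 1 / (2 * a ^ 2) := by gcongr
  have h2 : 0 ≤ σ ^ 2 - ρ ^ 2 := by nlinarith
  have h3 : -(σ ^ 2 - ρ ^ 2) / (2 * a ^ 2) = -(1 / (2 * a ^ 2)) * (σ ^ 2 - ρ ^ 2) := by ring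
  rw [h3]
  nlinarith

lemma gaussProfile_anti (d : ℕ) {w : ℝ} (hw : 0 < w) {ρ σ : ℝ} (hρ : 0 ≤ ρ)
    (h : ρ ≤ σ) : gaussProfile d w σ ≤ gaussProfile d w ρ := by
  unfold gaussProfile
  have : 0 ≤ 1 / (2 * w ^ 2) := by positivity
  gcongr ?_ * Real.exp ?_
  nlinarith [pow_le_pow_left₀ hρ h 2]

section mixProfile
variable {a : ℝ}

lemma integrable_gaussProfile (ha : 0 < a) (d : ℕ) (ρ : ℝ) :
    Integrable (fun w => gaussProfile d w ρ) (uniformLaw (Set.Icc a (2 * a))) := by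
  have := isProbabilityMeasure_uniformLaw_Icc ha
  refine Integrable.mono' (integrable_const ((2 * Real.pi * a ^ 2) ^ (-(d / 2) : ℝ)))
    ((measurable_gaussProfile d).comp measurable_prodMk_right).aestronglyMeasurable ?_
  filter_upwards [ae_mem_uniformLaw_Icc] with w hw
  rw [Real.norm_of_nonneg (gaussProfile_pos d (ha.trans_le hw.1) ρ).le]
  exact gaussProfile_le d ha hw.1 ρ

lemma continuous_mixProfile (ha : 0 < a) (d : ℕ) : Continuous (mixProfile a d) := by
  have := isProbabilityMeasure_uniformLaw_Icc ha
  refine continuous_of_dominated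
    (bound := fun _ => (2 * Real.pi * a ^ 2) ^ (-(d / 2) : ℝ))
    (fun ρ => (integrable_gaussProfile ha d ρ).aestronglyMeasurable) (fun ρ => ?_)
    (integrable_const _) (ae_of_all _ fun w => continuous_gaussProfile d w)
  filter_upwards [ae_mem_uniformLaw_Icc] with w hw
  rw [Real.norm_of_nonneg (gaussProfile_pos d (ha.trans_le hw.1) ρ).le]
  exact gaussProfile_le d ha hw.1 ρ

lemma mixProfile_mul_exp_le (ha : 0 < a) (d : ℕ) {ρ σ : ℝ} (hρ : 0 ≤ ρ) (h : ρ ≤ σ) :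
    mixProfile a d ρ * Real.exp (-(σ ^ 2 - ρ ^ 2) / (2 * a ^ 2)) ≤ mixProfile a d σ := by
  unfold mixProfile
  rw [← integral_mul_const]
  refine integral_mono_ae ((integrable_gaussProfile ha d ρ).mul_const _)
    (integrable_gaussProfile ha d σ) ?_
  filter_upwards [ae_mem_uniformLaw_Icc] with w hw
  exact gaussProfile_mul_exp_le d ha hw.1 hρ h

lemma mixProfile_anti (ha : 0 < a) (d : ℕ) {ρ σ : ℝ} (hρ : 0 ≤ ρ) (h : ρ ≤ σ) :
    mixProfile a d σ ≤ mixProfile a d ρ := by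
  refine integral_mono_ae (integrable_gaussProfile ha d σ) (integrable_gaussProfile ha d ρ) ?_
  filter_upwards [ae_pos_uniformLaw_Icc ha] with w hw
  exact gaussProfile_anti d hw hρ h

lemma mixProfile_pos (ha : 0 < a) (d : ℕ) (ρ : ℝ) : 0 < mixProfile a d ρ := by
  have := isProbabilityMeasure_uniformLaw_Icc ha
  unfold mixProfile
  rw [integral_pos_iff_support_of_nonneg_ae ?_ (integrable_gaussProfile ha d ρ)]
  · refine pos_iff_ne_zero.2 fun h => ?_
    have hae : ∀ᵐ w ∂(uniformLaw (Set.Icc a (2 * a))),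
        w ∉ Function.support fun w => gaussProfile d w ρ := measure_eq_zero_iff_ae_notMem.1 h
    obtain ⟨w, hw, hw0⟩ := (hae.and (ae_pos_uniformLaw_Icc ha)).exists
    exact hw (gaussProfile_pos d hw0 ρ).ne'
  · filter_upwards [ae_pos_uniformLaw_Icc ha] with w hw using (gaussProfile_pos d hw ρ).le

end mixProfile

/-! ### Gaussian measures and their mixture on a Euclidean space -/

section gaussMeasure
variable {V : Type*} [NormedAddCommGroup V] [InnerProductSpace ℝ V] [MeasurableSpace V]
  [BorelSpace V] [FiniteDimensional ℝ V]

lemma integrable_exp_neg_mul_sq_norm {b : ℝ} (hb : 0 < b) :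
    Integrable fun x : V => Real.exp (-b * ‖x‖ ^ 2) := by
  have := (GaussianFourier.integrable_cexp_neg_mul_sq_norm_add (V := V) (b := (b : ℂ))
    (by simpa using hb) 0 0).re
  refine this.congr (ae_of_all _ fun x => ?_)
  simp only [zero_mul, add_zero]
  have : (-(b : ℂ) * (‖x‖ : ℂ) ^ 2) = ((-b * ‖x‖ ^ 2 : ℝ) : ℂ) := by push_cast; rfl
  rw [this]
  exact Complex.exp_ofReal_re _

lemma lintegral_const_mul_exp_neg_mul_sq_norm {b c : ℝ} (hb : 0 < b) (hc : 0 ≤ c) :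
    ∫⁻ x : V, ENNReal.ofReal (c * Real.exp (-b * ‖x‖ ^ 2)) =
      ENNReal.ofReal (c * (Real.pi / b) ^ (Module.finrank ℝ V / 2 : ℝ)) := by
  rw [← ofReal_integral_eq_lintegral_ofReal ((integrable_exp_neg_mul_sq_norm hb).const_mul c)
    (ae_of_all _ fun x => by positivity), integral_const_mul,
    GaussianFourier.integral_rexp_neg_mul_sq_norm hb]

lemma isProbabilityMeasure_gaussMeasure {w : ℝ} (hw : 0 < w) :
    IsProbabilityMeasure (gaussMeasure V w) := by
  constructor
  unfold gaussMeasure gaussProfile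
  rw [withDensity_apply _ MeasurableSet.univ, Measure.restrict_univ,
    lintegral_const_mul_exp_neg_mul_sq_norm (by positivity) (by positivity)]
  have : Real.pi / (1 / (2 * w ^ 2)) = 2 * Real.pi * w ^ 2 := by field_simp
  rw [this, ← Real.rpow_add (by positivity)]
  simp

lemma map_inner_gaussMeasure {w : ℝ} (hw : 0 < w) {θ : V} (hθ : ‖θ‖ = 1) :
    (gaussMeasure V w).map (fun x => inner ℝ θ x) = gaussianReal 0 (Real.toNNReal (w ^ 2)) := by
  have := isProbabilityMeasure_gaussMeasure (V := V) hw
  have hm : Measurable fun x : V => (inner ℝ θ x : ℝ) := by fun_prop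
  have := Measure.isProbabilityMeasure_map (μ := gaussMeasure V w) hm.aemeasurable
  refine Measure.ext_of_charFun ?_
  ext s
  rw [charFun_apply_real, integral_map hm.aemeasurable (by fun_prop), gaussMeasure,
    integral_withDensity_eq_integral_toReal_smul (by unfold gaussProfile; fun_prop)
      (ae_of_all _ fun x => ENNReal.ofReal_lt_top), charFun_gaussianReal]
  have e : ∀ x : V, (ENNReal.ofReal (gaussProfile (Module.finrank ℝ V) w ‖x‖)).toReal •
      Complex.exp (s * ((inner ℝ θ x : ℝ) : ℂ) * Complex.I) =
      (((2 * Real.pi * w ^ 2) ^ (-(Module.finrank ℝ V / 2) : ℝ) : ℝ) : ℂ) *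
      Complex.exp (-((1 / (2 * w ^ 2) : ℝ) : ℂ) * (‖x‖ : ℂ) ^ 2 +
        (s * Complex.I) * ((inner ℝ θ x : ℝ) : ℂ)) := by
    intro x
    rw [ENNReal.toReal_ofReal (gaussProfile_pos _ hw _).le, gaussProfile, Complex.real_smul,
      Complex.ofReal_mul, Complex.ofReal_exp, mul_assoc, ← Complex.exp_add]
    congr 2
    push_cast
    ring
  simp_rw [e]
  have hb : 0 < ((1 / (2 * w ^ 2) : ℝ) : ℂ).re := by
    rw [Complex.ofReal_re]; positivity
  rw [integral_const_mul, GaussianFourier.integral_cexp_neg_mul_sq_norm_add hb, ← mul_assoc, hθ]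
  have h1 : ((Real.pi : ℂ) / ((1 / (2 * w ^ 2) : ℝ) : ℂ)) ^ (Module.finrank ℝ V / 2 : ℂ) =
      (((2 * Real.pi * w ^ 2) ^ (Module.finrank ℝ V / 2 : ℝ) : ℝ) : ℂ) := by
    rw [Complex.ofReal_cpow (by positivity)]
    congr 1
    · rw [← Complex.ofReal_div]; congr 1; field_simp
    · push_cast; rfl
  rw [h1, ← Complex.ofReal_mul, ← Real.rpow_add (by positivity)]
  have hw' : (w : ℂ) ≠ 0 := by exact_mod_cast hw.ne'
  have h2 : ((Real.toNNReal (w ^ 2) : ℝ≥0) : ℂ) = (w : ℂ) ^ 2 := by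
    have : ((Real.toNNReal (w ^ 2) : ℝ≥0) : ℝ) = w ^ 2 := Real.coe_toNNReal _ (by positivity)
    exact_mod_cast congrArg (fun r : ℝ => (r : ℂ)) this
  simp only [neg_add_cancel, Real.rpow_zero, Complex.ofReal_one, one_mul, mul_pow, Complex.I_sq,
    h2]
  congr 1
  push_cast
  field_simp
  ring

/-- Half of the exponent is spent on |x| > R. The other half is a Gaussian of variance 2w², whose
integral costs the factor 2^(d/2). -/
lemma gaussMeasure_norm_gt_le {w R : ℝ} (hw : 0 < w) (hR : 0 ≤ R) :
    gaussMeasure V w {x | R < ‖x‖} ≤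
      ENNReal.ofReal (2 ^ (Module.finrank ℝ V / 2 : ℝ) * Real.exp (-(R ^ 2 / (4 * w ^ 2)))) := by
  have hms : MeasurableSet {x : V | R < ‖x‖} := measurableSet_lt measurable_const measurable_norm
  unfold gaussMeasure
  rw [withDensity_apply _ hms]
  set c := (2 * Real.pi * w ^ 2) ^ (-(Module.finrank ℝ V / 2) : ℝ) with hc
  have hle : ∀ x ∈ {x : V | R < ‖x‖},
      ENNReal.ofReal (gaussProfile (Module.finrank ℝ V) w ‖x‖) ≤
      ENNReal.ofReal (c * Real.exp (-(R ^ 2 / (4 * w ^ 2))) *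
        Real.exp (-(1 / (4 * w ^ 2)) * ‖x‖ ^ 2)) := by
    intro x hx
    apply ENNReal.ofReal_le_ofReal
    rw [gaussProfile, ← hc, mul_assoc c, ← Real.exp_add]
    gcongr
    have hx' : R ^ 2 ≤ ‖x‖ ^ 2 := by
      have : R < ‖x‖ := hx
      gcongr
    have h3 : R ^ 2 / (4 * w ^ 2) ≤ ‖x‖ ^ 2 / (4 * w ^ 2) := by gcongr
    have h4 : -(1 / (2 * w ^ 2)) * ‖x‖ ^ 2 =
      -(‖x‖ ^ 2 / (4 * w ^ 2)) + -(1 / (4 * w ^ 2)) * ‖x‖ ^ 2 := by field_simp; ring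
    rw [h4]; linarith
  refine (setLIntegral_mono' hms hle).trans ((setLIntegral_le_lintegral _ _).trans ?_)
  rw [lintegral_const_mul_exp_neg_mul_sq_norm (by positivity) (by positivity)]
  apply ENNReal.ofReal_le_ofReal
  apply le_of_eq
  have h5 : Real.pi / (1 / (4 * w ^ 2)) = 2 * (2 * Real.pi * w ^ 2) := by field_simp; ring
  rw [h5, Real.mul_rpow (by positivity) (by positivity), hc, Real.rpow_neg (by positivity)]
  field_simp

lemma mixMeasure_apply {a : ℝ} (ha : 0 < a) {A : Set V} (hA : MeasurableSet A) :
    mixMeasure V a A = ∫⁻ w, gaussMeasure V w A ∂(uniformLaw (Set.Icc a (2 * a))) := by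
  have := isProbabilityMeasure_uniformLaw_Icc ha
  unfold mixMeasure gaussMeasure
  simp_rw [withDensity_apply _ hA]
  have e : ∀ x : V, ENNReal.ofReal (mixProfile a (Module.finrank ℝ V) ‖x‖) =
      ∫⁻ w, ENNReal.ofReal (gaussProfile (Module.finrank ℝ V) w ‖x‖)
        ∂(uniformLaw (Set.Icc a (2 * a))) := by
    intro x
    refine ofReal_integral_eq_lintegral_ofReal (integrable_gaussProfile ha _ _) ?_
    filter_upwards [ae_pos_uniformLaw_Icc ha] with w hw using (gaussProfile_pos _ hw _).le
  simp_rw [e]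
  rw [lintegral_lintegral_swap]
  refine Measurable.aemeasurable (ENNReal.measurable_ofReal.comp ?_)
  exact (measurable_gaussProfile (Module.finrank ℝ V)).comp
    (measurable_snd.prodMk measurable_fst.norm)

lemma isProbabilityMeasure_mixMeasure {a : ℝ} (ha : 0 < a) :
    IsProbabilityMeasure (mixMeasure V a) := by
  have := isProbabilityMeasure_uniformLaw_Icc ha
  constructor
  rw [mixMeasure_apply ha MeasurableSet.univ]
  rw [lintegral_congr_ae (g := fun _ => 1)]
  · simp
  · filter_upwards [ae_pos_uniformLaw_Icc ha] with w hw
    exact (isProbabilityMeasure_gaussMeasure hw).measure_univ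

/-- Given w, every unit direction sees N(0, w²), the law of w times a standard Gaussian; Tonelli
averages over w. -/
lemma map_inner_mixMeasure {a : ℝ} (ha : 0 < a) {θ : V} (hθ : ‖θ‖ = 1) :
    (mixMeasure V a).map (fun x => inner ℝ θ x) = gaussianMulUniform a := by
  have := isProbabilityMeasure_uniformLaw_Icc ha
  have hm : Measurable fun x : V => (inner ℝ θ x : ℝ) := by fun_prop
  have hm2 : Measurable fun q : ℝ × ℝ => q.1 * q.2 := by fun_prop
  ext A hA
  rw [Measure.map_apply hm hA, mixMeasure_apply ha (hm hA), gaussianMulUniform,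
    Measure.map_apply hm2 hA, Measure.prod_apply_symm (hm2 hA)]
  refine lintegral_congr_ae ?_
  filter_upwards [ae_pos_uniformLaw_Icc ha] with w hw
  rw [← Measure.map_apply hm hA, map_inner_gaussMeasure hw hθ]
  have h2 := gaussianReal_map_mul_const (μ := 0) (v := 1) w
  simp only [mul_zero, mul_one] at h2
  have hv : Real.toNNReal (w ^ 2) = NNReal.mk (w ^ 2) (sq_nonneg w) :=
    Real.toNNReal_of_nonneg (sq_nonneg w)
  rw [hv]
  change gaussianReal 0 (NNReal.mk (w ^ 2) (sq_nonneg w)) A = gaussianReal 0 1 ((fun g => g * w) ⁻¹' A)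
  rw [← h2, Measure.map_apply (by fun_prop) hA]

/-- As w ≤ 2a, the exponent R²/(4w²) is at least 2d, and 2^(d/2) ≤ e^d uses up only half of it. -/
lemma mixMeasure_norm_gt_le {a : ℝ} (ha : 0 < a) {R : ℝ} (hR : 0 ≤ R)
    (hR2 : 32 * a ^ 2 * Module.finrank ℝ V ≤ R ^ 2) :
    mixMeasure V a {x | R < ‖x‖} ≤ ENNReal.ofReal (Real.exp (-(Module.finrank ℝ V : ℝ))) := by
  have := isProbabilityMeasure_uniformLaw_Icc ha
  have hms : MeasurableSet {x : V | R < ‖x‖} := measurableSet_lt measurable_const measurable_norm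
  rw [mixMeasure_apply ha hms]
  set d := Module.finrank ℝ V
  have hle : ∀ᵐ w ∂(uniformLaw (Set.Icc a (2 * a))), gaussMeasure V w {x | R < ‖x‖} ≤
      ENNReal.ofReal (Real.exp (-(d : ℝ))) := by
    filter_upwards [ae_mem_uniformLaw_Icc] with w hw
    have hw0 : 0 < w := ha.trans_le hw.1
    refine (gaussMeasure_norm_gt_le hw0 hR).trans (ENNReal.ofReal_le_ofReal ?_)
    have h1 : (2 : ℝ) ^ (d / 2 : ℝ) ≤ Real.exp d := by
      have : (2 : ℝ) ≤ Real.exp 1 := by linarith [Real.add_one_le_exp (1 : ℝ)]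
      calc (2 : ℝ) ^ (d / 2 : ℝ) ≤ (Real.exp 1) ^ (d / 2 : ℝ) := by gcongr
        _ = Real.exp (d / 2) := by rw [← Real.exp_mul, one_mul]
        _ ≤ Real.exp d := by gcongr; linarith [(Nat.cast_nonneg d : (0 : ℝ) ≤ d)]
    have h2 : 2 * (d : ℝ) ≤ R ^ 2 / (4 * w ^ 2) := by
      rw [le_div_iff₀ (by positivity)]
      have : w ^ 2 ≤ (2 * a) ^ 2 := by gcongr; exact hw.2
      calc 2 * (d : ℝ) * (4 * w ^ 2) ≤ 2 * d * (4 * (2 * a) ^ 2) := by gcongr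
        _ = 32 * a ^ 2 * d := by ring
        _ ≤ R ^ 2 := hR2
    calc _ ≤ Real.exp d * Real.exp (-(2 * d)) := by gcongr
      _ = Real.exp (-(d : ℝ)) := by rw [← Real.exp_add]; ring_nf
  refine (lintegral_mono_ae hle).trans ?_
  simp

end gaussMeasure

/-! ### The one-dimensional law of G W -/

section gaussianMulUniform
variable {a : ℝ}

lemma isProbabilityMeasure_gaussianMulUniform (ha : 0 < a) :
    IsProbabilityMeasure (gaussianMulUniform a) := by
  have := isProbabilityMeasure_uniformLaw_Icc ha
  exact Measure.isProbabilityMeasure_map (by fun_prop)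

lemma map_neg_gaussianMulUniform (ha : 0 < a) :
    (gaussianMulUniform a).map (fun x => -x) = gaussianMulUniform a := by
  have := isProbabilityMeasure_uniformLaw_Icc ha
  unfold gaussianMulUniform
  rw [Measure.map_map (by fun_prop) (by fun_prop)]
  have h := (gaussianReal_map_neg (μ := 0) (v := 1))
  simp only [neg_zero] at h
  conv_rhs => rw [← h]
  have h3 := Measure.map_prod_map (gaussianReal 0 1) (uniformLaw (Set.Icc a (2 * a)))
    (f := fun x : ℝ => -x) (g := id) measurable_neg measurable_id
  rw [Measure.map_id] at h3
  rw [h3, Measure.map_map (by fun_prop) (by fun_prop)]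
  congr 1
  ext q
  simp

lemma charFun_gaussianMulUniform (ha : 0 < a) (t : ℝ) :
    charFun (gaussianMulUniform a) t =
      ((∫ w, Real.exp (-(w ^ 2 * t ^ 2 / 2)) ∂(uniformLaw (Set.Icc a (2 * a))) : ℝ) : ℂ) := by
  have := isProbabilityMeasure_uniformLaw_Icc ha
  rw [charFun_apply_real, gaussianMulUniform, integral_map (by fun_prop) (by fun_prop),
    integral_prod_symm]
  · rw [← integral_complex_ofReal]
    refine integral_congr_ae (ae_of_all _ fun w => ?_)
    have h := charFun_gaussianReal (μ := 0) (v := 1) (w * t)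
    rw [charFun_apply_real] at h
    simp only
    rw [Complex.ofReal_exp]
    convert h using 2
    · ext g; congr 1; push_cast; ring
    · push_cast; ring
  · refine Integrable.of_bound (by fun_prop) 1 (ae_of_all _ fun q => ?_)
    rw [← Complex.ofReal_mul, Complex.norm_exp_ofReal_mul_I]

/-- With Z = exp(-W²/2), the characteristic function at 1 and √2 is E Z and E Z². For a Gaussian
these are q and q², so Z has variance zero and W is constant, but W has no atoms. -/
lemma gaussianMulUniform_ne_gaussianReal (ha : 0 < a) (v : ℝ≥0) :
    gaussianMulUniform a ≠ gaussianReal 0 v := by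
  have := isProbabilityMeasure_uniformLaw_Icc ha
  intro heq
  set U := uniformLaw (Set.Icc a (2 * a)) with hU
  set Z : ℝ → ℝ := fun w => Real.exp (-(w ^ 2 / 2)) with hZ
  have hc : ∀ t : ℝ, ∫ w, Real.exp (-(w ^ 2 * t ^ 2 / 2)) ∂U = Real.exp (-(v * t ^ 2 / 2)) := by
    intro t
    have h1 := charFun_gaussianMulUniform ha t
    rw [heq, charFun_gaussianReal] at h1
    have h2 : (t * (0 : ℝ) * Complex.I - v * t ^ 2 / 2 : ℂ) = ((-(v * t ^ 2 / 2) : ℝ) : ℂ) := by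
      push_cast; ring_nf
    rw [h2, ← Complex.ofReal_exp] at h1
    exact_mod_cast h1.symm
  have h1 : ∫ w, Z w ∂U = Real.exp (-(v / 2)) := by simpa using hc 1
  have h2 : ∫ w, Z w ^ 2 ∂U = Real.exp (-(v / 2)) ^ 2 := by
    have := hc √2
    rw [Real.sq_sqrt (by norm_num)] at this
    rw [← Real.exp_nat_mul]
    convert this using 2
    · ext w; rw [hZ, ← Real.exp_nat_mul]; congr 1; push_cast; ring
    · push_cast; ring
  have hmem : MemLp Z 2 U := by
    refine MemLp.of_bound (by fun_prop) 1 (ae_of_all _ fun w => ?_)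
    rw [Real.norm_of_nonneg (Real.exp_pos _).le, Real.exp_le_one_iff]
    have : 0 ≤ w ^ 2 / 2 := by positivity
    linarith
  have hvar : variance Z U = 0 := by
    rw [variance_eq_sub hmem]
    simp only [Pi.pow_apply, h1, h2, sub_self]
  have hconst : Z =ᵐ[U] fun _ => Real.exp (-(v / 2)) := by
    have he : evariance Z U = 0 := by
      rw [← hmem.ofReal_variance_eq, hvar, ENNReal.ofReal_zero]
    rw [evariance_eq_zero_iff (by fun_prop)] at he
    rwa [h1] at he
  have hv : ∀ᵐ w ∂U, w = √v := by
    filter_upwards [hconst, ae_pos_uniformLaw_Icc ha] with w hw hw0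
    have : w ^ 2 = v := by
      have := Real.exp_injective hw
      linarith
    rw [← this, Real.sqrt_sq hw0.le]
  have hz : U {√(v : ℝ)} = 0 := by
    rw [hU, uniformLaw]
    exact cond_absolutelyContinuous (by simp)
  have : U {√(v : ℝ)}ᶜ = 0 := ae_iff.1 hv
  have h3 := prob_compl_eq_one_sub (μ := U) (measurableSet_singleton √(v : ℝ))
  rw [this, hz] at h3
  simp at h3

end gaussianMulUniform

lemma absGaussianMulUniformLaw_eq_map_abs :
    absGaussianMulUniformLaw = (gaussianMulUniform √(3 / 7)).map (fun x => |x|) := by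
  have ha : 0 < √(3 / 7 : ℝ) := by positivity
  have := isProbabilityMeasure_uniformLaw_Icc ha
  unfold absGaussianMulUniformLaw gaussianMulUniform
  rw [Measure.map_map (by fun_prop) (by fun_prop)]
  refine Measure.map_congr ?_
  have h : ∀ᵐ q ∂((gaussianReal 0 1).prod (uniformLaw (Set.Icc √(3 / 7) (2 * √(3 / 7))))),
      0 < q.2 := Measure.quasiMeasurePreserving_snd.ae (ae_pos_uniformLaw_Icc ha)
  filter_upwards [h] with q hq
  simp [abs_mul, abs_of_pos hq]

/-! ### Marginal laws of bodies -/

section marginal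

lemma marginalLaw_eq_map_inner {N : ℕ} (K : Set (EuclideanSpace ℝ (Fin N)))
    (E : Submodule ℝ (EuclideanSpace ℝ (Fin N))) {θ : EuclideanSpace ℝ (Fin N)} (hθ : θ ∈ E) :
    marginalLaw K E θ = (uniformLaw K).map (fun x => inner ℝ θ x) := by
  unfold marginalLaw
  congr 1
  ext x
  rw [← Submodule.inner_starProjection_left_eq_right, Submodule.starProjection_eq_self_iff.2 hθ]

lemma IsPConvexBody.volume_ne_zero {N : ℕ} {p : ℝ} {K : Set (EuclideanSpace ℝ (Fin N))}
    (hK : IsPConvexBody p K) : volume K ≠ 0 :=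
  (Measure.measure_pos_of_nonempty_interior volume hK.nonempty_interior).ne'

lemma IsPConvexBody.isProbabilityMeasure_uniformLaw {N : ℕ} {p : ℝ}
    {K : Set (EuclideanSpace ℝ (Fin N))} (hK : IsPConvexBody p K) :
    IsProbabilityMeasure (uniformLaw K) :=
  cond_isProbabilityMeasure_of_finite hK.volume_ne_zero hK.isCompact.measure_lt_top.ne

lemma IsPConvexBody.isProbabilityMeasure_marginalLaw {N : ℕ} {p : ℝ}
    {K : Set (EuclideanSpace ℝ (Fin N))} (hK : IsPConvexBody p K)
    (E : Submodule ℝ (EuclideanSpace ℝ (Fin N))) (θ : EuclideanSpace ℝ (Fin N)) :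
    IsProbabilityMeasure (marginalLaw K E θ) := by
  have := hK.isProbabilityMeasure_uniformLaw
  exact Measure.isProbabilityMeasure_map (by fun_prop)

end marginal

/-! ### The Euclidean ball, used in small dimensions -/

section ball

lemma rpow_one_div_half (x : ℝ) : x ^ (1 / (1 / 2) : ℝ) = x ^ 2 := by
  rw [one_div_one_div, Real.rpow_two]

lemma isPConvexBody_closedBall (N : ℕ) :
    IsPConvexBody (1 / 2) (Metric.closedBall (0 : EuclideanSpace ℝ (Fin N)) 1) where
  isPConvex := by
    refine ⟨by ext; simp, fun x hx y hy l hl hl1 => ?_⟩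
    rw [mem_closedBall_zero_iff] at *
    rw [rpow_one_div_half, rpow_one_div_half]
    refine (norm_add_le _ _).trans ?_
    rw [norm_smul, norm_smul, Real.norm_of_nonneg (by positivity),
      Real.norm_of_nonneg (by positivity)]
    nlinarith [mul_le_mul_of_nonneg_left hx (sq_nonneg l),
      mul_le_mul_of_nonneg_left hy (sq_nonneg (1 - l)), mul_pos hl (sub_pos.2 hl1)]
  isCompact := isCompact_closedBall _ _
  nonempty_interior := ⟨0, interior_mono Metric.ball_subset_closedBall
    (by rw [Metric.isOpen_ball.interior_eq]; simp)⟩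

/-- The reflection taking θ to θ' preserves the ball and its volume. -/
lemma map_inner_uniformLaw_closedBall_eq {N : ℕ} {θ θ' : EuclideanSpace ℝ (Fin N)}
    (h : ‖θ‖ = ‖θ'‖) :
    (uniformLaw (Metric.closedBall (0 : EuclideanSpace ℝ (Fin N)) 1)).map
      (fun x => inner ℝ θ x) =
    (uniformLaw (Metric.closedBall (0 : EuclideanSpace ℝ (Fin N)) 1)).map
      (fun x => inner ℝ θ' x) := by
  set T := Submodule.reflection (ℝ ∙ (θ - θ'))ᗮ with hT
  have hTθ : T θ = θ' := Submodule.reflection_sub h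
  have hmp : MeasurePreserving T := T.measurePreserving
  have hU : (uniformLaw (Metric.closedBall (0 : EuclideanSpace ℝ (Fin N)) 1)).map T =
      uniformLaw (Metric.closedBall (0 : EuclideanSpace ℝ (Fin N)) 1) := by
    unfold uniformLaw ProbabilityTheory.cond
    rw [Measure.map_smul]
    congr 1
    have := hmp.restrict_preimage (s := Metric.closedBall (0 : EuclideanSpace ℝ (Fin N)) 1)
      measurableSet_closedBall
    have hpre : T ⁻¹' Metric.closedBall (0 : EuclideanSpace ℝ (Fin N)) 1 =
        Metric.closedBall (0 : EuclideanSpace ℝ (Fin N)) 1 := by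
      ext x; simp
    rw [hpre] at this
    exact this.map_eq
  conv_rhs => rw [← hU]
  rw [Measure.map_map (by fun_prop) T.continuous.measurable]
  congr 1
  ext x
  simp only [Function.comp_apply]
  rw [← hTθ, T.inner_map_map]

lemma map_neg_map_inner_uniformLaw_closedBall {N : ℕ} (θ : EuclideanSpace ℝ (Fin N)) :
    ((uniformLaw (Metric.closedBall (0 : EuclideanSpace ℝ (Fin N)) 1)).map
      (fun x => inner ℝ θ x)).map (fun x => -x) =
    (uniformLaw (Metric.closedBall (0 : EuclideanSpace ℝ (Fin N)) 1)).map
      (fun x => inner ℝ θ x) := by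
  rw [Measure.map_map (by fun_prop) (by fun_prop),
    ← map_inner_uniformLaw_closedBall_eq (norm_neg θ)]
  congr 1
  ext x
  simp

/-- A point mass at 0 is excluded because the hyperplane orthogonal to θ is null; a nondegenerate
Gaussian, because it charges (1, ∞). -/
lemma map_inner_uniformLaw_closedBall_ne_gaussianReal {N : ℕ} {θ : EuclideanSpace ℝ (Fin N)}
    (hθ : ‖θ‖ = 1) (v : ℝ≥0) :
    (uniformLaw (Metric.closedBall (0 : EuclideanSpace ℝ (Fin N)) 1)).map
      (fun x => inner ℝ θ x) ≠ gaussianReal 0 v := by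
  intro heq
  by_cases hv : v = 0
  · subst hv
    rw [gaussianReal_zero_var] at heq
    have h1 := congrArg (fun μ : Measure ℝ => μ {0}) heq
    rw [Measure.map_apply (by fun_prop) (measurableSet_singleton _)] at h1
    have h2 : uniformLaw (Metric.closedBall (0 : EuclideanSpace ℝ (Fin N)) 1)
        ((fun x => (inner ℝ θ x : ℝ)) ⁻¹' {0}) = 0 := by
      refine cond_absolutelyContinuous ?_
      have h3 : ((fun x => (inner ℝ θ x : ℝ)) ⁻¹' {0}) =
          (((ℝ ∙ θ)ᗮ : Submodule ℝ (EuclideanSpace ℝ (Fin N))) : Set _) := by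
        ext x
        simp [Submodule.mem_orthogonal_singleton_iff_inner_right]
      rw [h3]
      refine Measure.addHaar_submodule _ _ fun htop => ?_
      have h4 : θ ∈ (ℝ ∙ θ)ᗮ := htop ▸ Submodule.mem_top
      rw [Submodule.mem_orthogonal_singleton_iff_inner_right, real_inner_self_eq_norm_sq, hθ] at h4
      norm_num at h4
    rw [h2] at h1
    simp at h1
  · have h1 : gaussianReal 0 v (Set.Ioi 1) = 0 := by
      rw [← heq, Measure.map_apply (by fun_prop) measurableSet_Ioi]
      have h2 : ∀ᵐ x ∂(uniformLaw (Metric.closedBall (0 : EuclideanSpace ℝ (Fin N)) 1)),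
          x ∈ Metric.closedBall (0 : EuclideanSpace ℝ (Fin N)) 1 :=
        ae_cond_mem measurableSet_closedBall
      refine measure_mono_null ?_ h2
      intro x hx hx'
      have hx' : x ∈ Metric.closedBall (0 : EuclideanSpace ℝ (Fin N)) 1 := hx'
      have hx : (1 : ℝ) < inner ℝ θ x := hx
      rw [mem_closedBall_zero_iff] at hx'
      have := real_inner_le_norm θ x
      rw [hθ] at this
      linarith
    have h2 := gaussianReal_absolutelyContinuous' 0 hv h1
    simp at h2

/-- All unit directions share one law, so the gap of a single direction serves for all subspaces. -/
lemma exists_gap_marginalLaw_closedBall (N : ℕ) :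
    ∃ c : ℝ, 0 < c ∧ ∀ (E : Submodule ℝ (EuclideanSpace ℝ (Fin N))), ∀ θ ∈ E, ‖θ‖ = 1 →
      ∀ (m : ℝ) (v : ℝ≥0),
        ¬ LevyClose c (marginalLaw (Metric.closedBall 0 1) E θ) (gaussianReal m v) := by
  by_cases hex : ∃ θ : EuclideanSpace ℝ (Fin N), ‖θ‖ = 1
  · obtain ⟨θ₀, hθ₀⟩ := hex
    have hp : IsProbabilityMeasure ((uniformLaw (Metric.closedBall
        (0 : EuclideanSpace ℝ (Fin N)) 1)).map (fun x => inner ℝ θ₀ x)) := by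
      have := (isPConvexBody_closedBall N).isProbabilityMeasure_uniformLaw
      exact Measure.isProbabilityMeasure_map (by fun_prop)
    obtain ⟨c, hc, h⟩ := exists_forall_not_levyClose_gaussianReal
      (map_neg_map_inner_uniformLaw_closedBall θ₀)
      (map_inner_uniformLaw_closedBall_ne_gaussianReal hθ₀)
    refine ⟨c, hc, fun E θ hθE hθ m v => ?_⟩
    rw [marginalLaw_eq_map_inner _ _ hθE,
      map_inner_uniformLaw_closedBall_eq (hθ.trans hθ₀.symm)]
    exact h m v
  · exact ⟨1, one_pos, fun E θ _ hθ => absurd ⟨θ, hθ⟩ hex⟩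

end ball

/-! ### Bodies of revolution: 1/2-convexity and projection to the axis -/

section revBody

/-- The body of revolution with axis `E` and radial profile `r`, truncated at distance `R`. -/
def revBody {V : Type*} [NormedAddCommGroup V] [InnerProductSpace ℝ V] [FiniteDimensional ℝ V]
    (E : Submodule ℝ V) (R : ℝ) (r : ℝ → ℝ) : Set V :=
  {z | ‖E.starProjection z‖ ≤ R ∧ ‖Eᗮ.starProjection z‖ ≤ r ‖E.starProjection z‖}

lemma isClosed_revBody {V : Type*} [NormedAddCommGroup V] [InnerProductSpace ℝ V]
    [FiniteDimensional ℝ V] (E : Submodule ℝ V) (R : ℝ) {r : ℝ → ℝ} (hcont : Continuous r) :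
    IsClosed (revBody E R r) := by
  have h1 : IsClosed {z : V | ‖E.starProjection z‖ ≤ R} := isClosed_le (by fun_prop) (by fun_prop)
  have h2 : IsClosed {z : V | ‖Eᗮ.starProjection z‖ ≤ r ‖E.starProjection z‖} :=
    isClosed_le (by fun_prop) (by fun_prop)
  exact h1.inter h2

/-- A decreasing profile that decreases slowly satisfies the inequality needed for
`1/2`-convexity. -/
lemma profile_half_convex {r : ℝ → ℝ} {R b : ℝ} (hb : 0 < b) (hRb : 3 * R ^ 2 ≤ 2 * b)
    (hpos : ∀ ρ, 0 < r ρ) (hanti : ∀ ρ σ, 0 ≤ ρ → ρ ≤ σ → r σ ≤ r ρ)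
    (hslow : ∀ ρ σ, 0 ≤ ρ → ρ ≤ σ → r ρ * Real.exp (-(σ ^ 2 - ρ ^ 2) / (2 * b)) ≤ r σ)
    {ρ ρ' l : ℝ} (hρ : 0 ≤ ρ) (hρR : ρ ≤ R) (hρ' : 0 ≤ ρ') (hρR' : ρ' ≤ R) (hl : 0 < l)
    (hl1 : l < 1) :
    l ^ 2 * r ρ + (1 - l) ^ 2 * r ρ' ≤ r (l ^ 2 * ρ + (1 - l) ^ 2 * ρ') := by
  -- By symmetry ε is the smaller weight, so the combined point lies beyond ρ by at most ε²R.
  have main : ∀ ρ ρ' ε : ℝ, 0 ≤ ρ → ρ ≤ R → 0 ≤ ρ' → ρ' ≤ R → 0 < ε → ε ≤ 1 / 2 →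
      (1 - ε) ^ 2 * r ρ + ε ^ 2 * r ρ' ≤ r ((1 - ε) ^ 2 * ρ + ε ^ 2 * ρ') := by
    clear! ρ ρ' l
    intro ρ ρ' ε hρ hρR hρ' hρR' hε hε1
    have hR : 0 ≤ R := hρ.trans hρR
    have hr := hpos ρ
    -- On [0, R] the exponent is at least -R²/(2b) ≥ -1/3, so r keeps at least 2/3 of r(0).
    have h1 : r ρ' ≤ 3 / 2 * r ρ := by
      have e1 := hslow 0 ρ le_rfl hρ
      have e2 := hanti 0 ρ' le_rfl hρ'
      have e3 := Real.add_one_le_exp (-(ρ ^ 2 - 0 ^ 2) / (2 * b))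
      have e4 : -(1 / 3) ≤ -(ρ ^ 2 - 0 ^ 2) / (2 * b) := by
        rw [le_div_iff₀ (by positivity)]
        nlinarith [pow_le_pow_left₀ hρ hρR 2]
      have e5 : r 0 * (2 / 3) ≤ r ρ :=
        (mul_le_mul_of_nonneg_left (by linarith) (hpos 0).le).trans e1
      linarith
    -- The slack of the squared weights: (1-ε)² + (3/2)ε² ≤ 1 - ε² for ε ≤ 4/7, in particular for ε
    -- ≤ 1/2.
    have h2 : (1 - ε) ^ 2 * r ρ + ε ^ 2 * r ρ' ≤ r ρ * (1 - ε ^ 2) := by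
      have : ε ^ 2 * r ρ' ≤ ε ^ 2 * (3 / 2 * r ρ) := by gcongr
      have h3 : 0 ≤ r ρ * (ε * (1 / 2 - ε)) := by
        have : 0 ≤ 1 / 2 - ε := by linarith
        positivity
      have h4 : 0 ≤ r ρ * ε := by positivity
      nlinarith
    set σ := (1 - ε) ^ 2 * ρ + ε ^ 2 * ρ' with hσ
    have hσ0 : 0 ≤ σ := by positivity
    rcases le_total σ ρ with h | h
    · have := hanti σ ρ hσ0 h
      nlinarith [mul_nonneg hr.le (sq_nonneg ε)]
    · refine h2.trans (le_trans ?_ (hslow ρ σ hρ h))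
      gcongr
      have e3 := Real.add_one_le_exp (-(σ ^ 2 - ρ ^ 2) / (2 * b))
      have hε2 : ε ^ 2 ≤ 1 := by nlinarith
      have e5 : σ - ρ ≤ ε ^ 2 * R := by
        have : ε ^ 2 * ρ' ≤ ε ^ 2 * R := by gcongr
        nlinarith [mul_nonneg hρ (mul_nonneg hε.le (by linarith : 0 ≤ 2 - ε))]
      have e6 : σ + ρ ≤ 3 * R := by nlinarith
      have e7 : σ ^ 2 - ρ ^ 2 ≤ 3 * ε ^ 2 * R ^ 2 := by
        calc σ ^ 2 - ρ ^ 2 = (σ - ρ) * (σ + ρ) := by ring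
          _ ≤ ε ^ 2 * R * (3 * R) := by gcongr
          _ = _ := by ring
      -- Moving out from ρ to σ costs at most the factor exp(-ε²) ≥ 1 - ε², which the slack pays
      -- for.
      have e4 : -ε ^ 2 ≤ -(σ ^ 2 - ρ ^ 2) / (2 * b) := by
        rw [le_div_iff₀ (by positivity)]
        nlinarith [mul_le_mul_of_nonneg_left hRb (sq_nonneg ε)]
      linarith
  rcases le_total l (1 / 2) with h | h
  · have := main ρ' ρ l hρ' hρR' hρ hρR hl h
    rw [add_comm, add_comm (l ^ 2 * ρ)]
    exact this
  · have := main ρ ρ' (1 - l) hρ hρR hρ' hρR' (by linarith) (by linarith)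
    simpa using this

lemma isPConvexBody_revBody {N : ℕ} (E : Submodule ℝ (EuclideanSpace ℝ (Fin N))) {R : ℝ}
    (hR : 0 < R) {r : ℝ → ℝ} (hcont : Continuous r) (hpos : ∀ ρ, 0 < r ρ)
    (hanti : ∀ ρ σ, 0 ≤ ρ → ρ ≤ σ → r σ ≤ r ρ)
    (hconv : ∀ ρ ρ' l : ℝ, 0 ≤ ρ → ρ ≤ R → 0 ≤ ρ' → ρ' ≤ R → 0 < l → l < 1 →
      l ^ 2 * r ρ + (1 - l) ^ 2 * r ρ' ≤ r (l ^ 2 * ρ + (1 - l) ^ 2 * ρ')) :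
    IsPConvexBody (1 / 2) (revBody E R r) where
  isPConvex := by
    refine ⟨by ext; simp only [revBody, Set.mem_neg, Set.mem_ofPred_eq, map_neg, norm_neg],
      fun x hx y hy l hl hl1 => ?_⟩
    have hnorm : ∀ F : Submodule ℝ (EuclideanSpace ℝ (Fin N)),
        ‖F.starProjection (l ^ 2 • x + (1 - l) ^ 2 • y)‖ ≤
          l ^ 2 * ‖F.starProjection x‖ + (1 - l) ^ 2 * ‖F.starProjection y‖ := by
      intro F
      rw [map_add, map_smul, map_smul]
      refine (norm_add_le _ _).trans ?_
      rw [norm_smul, norm_smul, Real.norm_of_nonneg (by positivity),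
        Real.norm_of_nonneg (by positivity)]
    rw [rpow_one_div_half, rpow_one_div_half]
    refine ⟨(hnorm E).trans ?_, (hnorm Eᗮ).trans ?_⟩
    · nlinarith [mul_le_mul_of_nonneg_left hx.1 (sq_nonneg l),
        mul_le_mul_of_nonneg_left hy.1 (sq_nonneg (1 - l)),
        mul_pos hR (mul_pos hl (sub_pos.2 hl1))]
    -- The triangle inequality only bounds the axial norm of the combination from above; since r
    -- decreases, replacing it by the bound is safe.
    · refine le_trans ?_ (hanti _ _ (norm_nonneg _) (hnorm E))
      refine le_trans ?_ (hconv _ _ l (norm_nonneg _) hx.1 (norm_nonneg _) hy.1 hl hl1)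
      gcongr
      · exact hx.2
      · exact hy.2
  isCompact := by
    refine Metric.isCompact_of_isClosed_isBounded ?_ ?_
    · exact isClosed_revBody E R hcont
    · refine (Metric.isBounded_closedBall (x := 0) (r := R + r 0)).subset fun z hz => ?_
      rw [mem_closedBall_zero_iff, ← E.starProjection_add_starProjection_orthogonal z]
      exact (norm_add_le _ _).trans
        (add_le_add hz.1 (hz.2.trans (hanti _ _ le_rfl (norm_nonneg _))))
  nonempty_interior := by
    refine ⟨0, mem_interior.2 ⟨{z | ‖E.starProjection z‖ < R} ∩
      {z | ‖Eᗮ.starProjection z‖ < r ‖E.starProjection z‖},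
      fun z hz => ⟨le_of_lt hz.1, le_of_lt hz.2⟩,
      ?_, ?_⟩⟩
    · exact (isOpen_lt (by fun_prop) (by fun_prop)).inter
        (isOpen_lt (by fun_prop) (by fun_prop))
    · simp [hR, hpos]

variable {V : Type*} [NormedAddCommGroup V] [InnerProductSpace ℝ V] [FiniteDimensional ℝ V]
  [MeasurableSpace V] [BorelSpace V]

lemma measurePreserving_orthogonalProjectionOnto_prod (E : Submodule ℝ V) :
    MeasurePreserving (fun z : V =>
      ((E.orthogonalProjectionOnto z, Eᗮ.orthogonalProjectionOnto z) : E × Eᗮ)) := by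
  have h1 := E.orthogonalDecomposition.measurePreserving
  have h2 := WithLp.volume_preserving_ofLp E Eᗮ
  convert h2.comp h1 using 1
  ext z <;> simp

/-- Fubini along E: the fibre over x is a ball of radius r(|x|), with volume proportional to r(|x|)
to the codimension. -/
lemma volume_revBody_inter (E : Submodule ℝ V) {R : ℝ} {r : ℝ → ℝ} (hcont : Continuous r)
    (hpos : ∀ ρ, 0 < r ρ) {A : Set E} (hA : MeasurableSet A) :
    volume (revBody E R r ∩ (fun z => E.orthogonalProjectionOnto z) ⁻¹' A) =
      volume (Metric.ball (0 : Eᗮ) 1) *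
        volume.withDensity (fun x : E => ENNReal.ofReal (r ‖x‖ ^ Module.finrank ℝ Eᗮ))
          (Metric.closedBall 0 R ∩ A) := by
  set S : Set (E × Eᗮ) := {q | q.1 ∈ Metric.closedBall 0 R ∩ A ∧ ‖q.2‖ ≤ r ‖q.1‖} with hS
  have hBA : MeasurableSet (Metric.closedBall (0 : E) R ∩ A) := measurableSet_closedBall.inter hA
  have hSm2 : MeasurableSet {q : E × Eᗮ | ‖q.2‖ ≤ r ‖q.1‖} :=
    measurableSet_le (by fun_prop) (by fun_prop)
  have hSm : MeasurableSet S := (measurable_fst hBA).inter hSm2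
  have hpre : revBody E R r ∩ (fun z => E.orthogonalProjectionOnto z) ⁻¹' A =
      (fun z : V => ((E.orthogonalProjectionOnto z, Eᗮ.orthogonalProjectionOnto z) : E × Eᗮ)) ⁻¹' S
      := by
    ext z
    simp only [revBody, hS, Set.mem_inter_iff, Set.mem_preimage, Set.mem_ofPred_eq,
      mem_closedBall_zero_iff, Submodule.starProjection_apply, Submodule.coe_norm]
    tauto
  rw [hpre, (measurePreserving_orthogonalProjectionOnto_prod E).measure_preimage
    hSm.nullMeasurableSet, withDensity_apply _ hBA, Measure.volume_eq_prod,
    Measure.prod_apply hSm, ← lintegral_indicator hBA, ← lintegral_const_mul]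
  · refine lintegral_congr fun x => ?_
    by_cases hx : x ∈ Metric.closedBall (0 : E) R ∩ A
    · have : Prod.mk x ⁻¹' S = Metric.closedBall (0 : Eᗮ) (r ‖x‖) := by
        ext y
        simp only [hS, Set.mem_preimage, Set.mem_ofPred_eq, mem_closedBall_zero_iff]
        exact and_iff_right hx
      rw [this, Measure.addHaar_closedBall _ _ (hpos _).le, Set.indicator_of_mem hx, mul_comm]
    · have : Prod.mk x ⁻¹' S = ∅ := by
        ext y
        simp only [hS, Set.mem_preimage, Set.mem_ofPred_eq, Set.mem_empty_iff_false, iff_false]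
        exact fun h => hx h.1
      rw [this, Set.indicator_of_notMem hx, measure_empty, mul_zero]
  · exact Measurable.indicator (by fun_prop) hBA

/-- The projection of the uniform law of a body of revolution to its axis. -/
lemma map_orthogonalProjectionOnto_uniformLaw_revBody (E : Submodule ℝ V) {R : ℝ} {r : ℝ → ℝ}
    (hcont : Continuous r) (hpos : ∀ ρ, 0 < r ρ) :
    (cond volume (revBody E R r)).map (fun z => E.orthogonalProjectionOnto z) =
      cond (volume.withDensity fun x : E => ENNReal.ofReal (r ‖x‖ ^ Module.finrank ℝ Eᗮ))
        (Metric.closedBall 0 R) := by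
  have hc0 : volume (Metric.ball (0 : Eᗮ) 1) ≠ 0 :=
    (Metric.measure_ball_pos volume _ one_pos).ne'
  have hc1 : volume (Metric.ball (0 : Eᗮ) 1) ≠ ∞ := measure_ball_lt_top.ne
  have hKm : MeasurableSet (revBody E R r) :=
    (isClosed_revBody E R hcont).measurableSet
  have hvol := volume_revBody_inter E (R := R) hcont hpos MeasurableSet.univ
  simp only [Set.preimage_univ, Set.inter_univ] at hvol
  ext A hA
  rw [Measure.map_apply (by fun_prop) hA, cond_apply hKm, cond_apply measurableSet_closedBall,
    volume_revBody_inter E hcont hpos hA, hvol, ENNReal.mul_inv (Or.inl hc0) (Or.inl hc1)]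
  rw [show ∀ x y z w : ℝ≥0∞, x * y * (z * w) = (x * z) * (y * w) from fun x y z w => by ring,
    ENNReal.inv_mul_cancel hc0 hc1, one_mul]

end revBody

/-! ### The body whose marginals are close to G W -/

/-- The difference is γ(Bᶜ) times the conditional probability of A, minus γ(A \ B); both terms lie
in [0, γ(Bᶜ)]. -/
lemma abs_real_cond_sub_real_le {Ω : Type*} [MeasurableSpace Ω] (γ : Measure Ω)
    [IsProbabilityMeasure γ] {B : Set Ω} (hB : MeasurableSet B) (A : Set Ω) (h0 : γ B ≠ 0) :
    |(cond γ B).real A - γ.real A| ≤ γ.real Bᶜ := by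
  have h1 : (cond γ B).real A = (γ.real B)⁻¹ * γ.real (B ∩ A) := by
    rw [measureReal_def, cond_apply hB, ENNReal.toReal_mul, ENNReal.toReal_inv]; rfl
  have hp : 0 < γ.real B := ENNReal.toReal_pos h0 (by finiteness)
  have h2 : γ.real (A ∩ B) + γ.real (A \ B) = γ.real A := measureReal_inter_add_sdiff hB
  have h3 : γ.real (A \ B) ≤ γ.real Bᶜ := measureReal_mono fun x hx => hx.2
  have h4 : γ.real Bᶜ = 1 - γ.real B := probReal_compl_eq_one_sub hB
  have h5 : γ.real (A ∩ B) ≤ γ.real B := measureReal_mono Set.inter_subset_right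
  have h6 := measureReal_nonneg (μ := γ) (s := A \ B)
  have h7 := measureReal_nonneg (μ := γ) (s := A ∩ B)
  have h8 := measureReal_le_one (μ := γ) (s := B)
  rw [h1, Set.inter_comm, ← h2]
  set p := γ.real B
  set x := γ.real (A ∩ B)
  have h9 : p⁻¹ * x = x + (1 - p) * (p⁻¹ * x) := by field_simp; ring
  have h10 : p⁻¹ * x ≤ 1 := by rw [inv_mul_le_iff₀ hp]; linarith
  have h11 : 0 ≤ p⁻¹ * x := by positivity
  have h12 : 0 ≤ (1 - p) * (p⁻¹ * x) := mul_nonneg (by linarith) h11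
  have h13 : (1 - p) * (p⁻¹ * x) ≤ 1 - p := mul_le_of_le_one_right (by linarith) h10
  rw [abs_le]
  constructor <;> linarith

lemma exists_submodule_finrank_eq {N n : ℕ} (h : n ≤ N) :
    ∃ E : Submodule ℝ (EuclideanSpace ℝ (Fin N)), Module.finrank ℝ E = n := by
  have hli : LinearIndependent ℝ
      (fun i : Fin n => EuclideanSpace.basisFun (Fin N) ℝ (Fin.castLE h i)) :=
    (EuclideanSpace.basisFun (Fin N) ℝ).orthonormal.linearIndependent.comp _
      (Fin.castLE_injective h)
  exact ⟨_, (finrank_span_eq_card hli).trans (Fintype.card_fin n)⟩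

lemma le_ambientDim {n : ℕ} (hn : 16 ≤ n) : 49 * n ≤ ambientDim n := by
  suffices h : (48 * n : ℝ) ≤ (⌈(n : ℝ) ^ (5 / 2 : ℝ) * Real.log n ^ 2⌉₊ : ℝ) by
    have : 48 * n ≤ ⌈(n : ℝ) ^ (5 / 2 : ℝ) * Real.log n ^ 2⌉₊ := by exact_mod_cast h
    unfold ambientDim
    omega
  refine le_trans ?_ (Nat.le_ceil _)
  have hn' : (16 : ℝ) ≤ n := by exact_mod_cast hn
  have h1 : 1 ≤ Real.log n := by
    rw [Real.le_log_iff_exp_le (by linarith)]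
    linarith [Real.exp_one_lt_d9]
  have h2 : (n : ℝ) ^ (5 / 2 : ℝ) = n * (n : ℝ) ^ (3 / 2 : ℝ) := by
    rw [← Real.rpow_one_add' (by positivity) (by norm_num)]; norm_num
  have h3 : (48 : ℝ) ≤ (n : ℝ) ^ (3 / 2 : ℝ) := by
    have e1 : ((4 : ℝ) ^ (2 : ℝ)) ^ (3 / 2 : ℝ) = 64 := by
      rw [← Real.rpow_mul (by norm_num)]; norm_num
    have e2 : ((4 : ℝ) ^ (2 : ℝ)) ≤ n := by rw [Real.rpow_two]; linarith
    calc (48 : ℝ) ≤ ((4 : ℝ) ^ (2 : ℝ)) ^ (3 / 2 : ℝ) := by rw [e1]; norm_num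
      _ ≤ _ := by gcongr
  rw [h2]
  calc (48 * n : ℝ) = n * 48 * 1 ^ 2 := by ring
    _ ≤ n * (n : ℝ) ^ (3 / 2 : ℝ) * Real.log n ^ 2 := by gcongr

/-- In codimension at least `48 n` there is a `1/2`-convex body of revolution whose marginals on its
`n`-dimensional axis are exponentially close to the scale mixture of Gaussians. -/
lemma exists_isPConvexBody_marginal_close {a : ℝ} (ha : 0 < a) {n N : ℕ} (hn : 1 ≤ n)
    (hN : 49 * n ≤ N) :
    ∃ K : Set (EuclideanSpace ℝ (Fin N)), IsPConvexBody (1 / 2) K ∧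
      ∃ E : Submodule ℝ (EuclideanSpace ℝ (Fin N)), Module.finrank ℝ E = n ∧
      ∀ θ ∈ E, ‖θ‖ = 1 → ∀ A : Set ℝ, MeasurableSet A →
        |(marginalLaw K E θ).real A - (gaussianMulUniform a).real A| ≤ Real.exp (-n) := by
  obtain ⟨E, hE⟩ := exists_submodule_finrank_eq (n := n) (N := N) (by omega)
  obtain ⟨M, rfl⟩ := Nat.exists_eq_add_of_le (show n ≤ N by omega)
  have hM : 48 * n ≤ M := by omega
  have hE' : Module.finrank ℝ Eᗮ = M := by
    have := E.finrank_add_finrank_orthogonal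
    rw [finrank_euclideanSpace_fin, hE] at this
    omega
  have hn0 : (0 : ℝ) < n := by exact_mod_cast hn
  have hM' : (48 * n : ℝ) ≤ M := by exact_mod_cast hM
  have hM0 : (0 : ℝ) < M := by linarith
  -- This meets the tail bound with equality, and 3R² = 96a²n ≤ 2a²M is exactly the condition M ≥
  -- 48n.
  set R : ℝ := √(32 * a ^ 2 * n) with hRdef
  have hR : 0 < R := by positivity
  have hR2 : R ^ 2 = 32 * a ^ 2 * n := Real.sq_sqrt (by positivity)
  -- The M-th root undoes the power M in the fibre volume and divides the logarithmic decay rate by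
  -- M.
  set r : ℝ → ℝ := fun ρ => mixProfile a n ρ ^ (1 / M : ℝ) with hr
  have hcont : Continuous r :=
    (continuous_mixProfile ha n).rpow_const fun ρ => Or.inr (by positivity)
  have hpos : ∀ ρ, 0 < r ρ := fun ρ => Real.rpow_pos_of_pos (mixProfile_pos ha n ρ) _
  have hanti : ∀ ρ σ, 0 ≤ ρ → ρ ≤ σ → r σ ≤ r ρ := fun ρ σ hρ h =>
    Real.rpow_le_rpow (mixProfile_pos ha n σ).le (mixProfile_anti ha n hρ h) (by positivity)
  have hslow : ∀ ρ σ, 0 ≤ ρ → ρ ≤ σ →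
      r ρ * Real.exp (-(σ ^ 2 - ρ ^ 2) / (2 * (a ^ 2 * M))) ≤ r σ := by
    intro ρ σ hρ h
    have h1 := Real.rpow_le_rpow (mul_pos (mixProfile_pos ha n ρ) (Real.exp_pos _)).le
      (mixProfile_mul_exp_le ha n hρ h) (z := (1 / M : ℝ)) (by positivity)
    rw [Real.mul_rpow (mixProfile_pos ha n ρ).le (Real.exp_pos _).le, ← Real.exp_mul] at h1
    convert h1 using 3
    field_simp
  have hK : IsPConvexBody (1 / 2) (revBody E R r) :=
    isPConvexBody_revBody E hR hcont hpos hanti fun ρ ρ' l hρ hρR hρ' hρR' hl hl1 =>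
      profile_half_convex (b := a ^ 2 * M) (by positivity)
        (by rw [hR2]; nlinarith [mul_le_mul_of_nonneg_left hM' (sq_nonneg a)])
        hpos hanti hslow hρ hρR hρ' hρR' hl hl1
  refine ⟨revBody E R r, hK, E, hE, fun θ hθE hθ A hA => ?_⟩
  have hγ := isProbabilityMeasure_mixMeasure (V := E) ha
  have hdens : (volume.withDensity fun x : E => ENNReal.ofReal (r ‖x‖ ^ Module.finrank ℝ Eᗮ)) =
      mixMeasure E a := by
    unfold mixMeasure
    congr 1
    ext x
    rw [hE, hE', hr, ← Real.rpow_natCast, ← Real.rpow_mul (mixProfile_pos ha n _).le,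
      one_div_mul_cancel hM0.ne', Real.rpow_one]
  set θ' : E := ⟨θ, hθE⟩ with hθ'
  have hθ'1 : ‖θ'‖ = 1 := hθ
  have hm : Measurable fun x : E => (inner ℝ θ' x : ℝ) := by fun_prop
  have hlaw : marginalLaw (revBody E R r) E θ =
      (cond (mixMeasure E a) (Metric.closedBall 0 R)).map (fun x => inner ℝ θ' x) := by
    rw [← hdens, ← map_orthogonalProjectionOnto_uniformLaw_revBody E hcont hpos,
      Measure.map_map hm (by fun_prop)]
    rfl
  have htail : (mixMeasure E a).real (Metric.closedBall 0 R)ᶜ ≤ Real.exp (-n) := by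
    have h1 := mixMeasure_norm_gt_le (V := E) ha hR.le (by rw [hR2, hE])
    rw [hE] at h1
    have h2 : (Metric.closedBall (0 : E) R)ᶜ = {x | R < ‖x‖} := by ext; simp
    rw [h2]
    exact ENNReal.toReal_le_of_le_ofReal (Real.exp_pos _).le h1
  have hB0 : mixMeasure E a (Metric.closedBall 0 R) ≠ 0 := by
    intro h0
    have h1 := probReal_compl_eq_one_sub (μ := mixMeasure E a)
      (measurableSet_closedBall (x := (0 : E)) (ε := R))
    rw [measureReal_def (s := Metric.closedBall (0 : E) R), h0] at h1
    have h2 : Real.exp (-(n : ℝ)) < 1 := Real.exp_lt_one_iff.2 (by linarith)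
    simp only [ENNReal.toReal_zero, sub_zero] at h1
    linarith
  rw [hlaw, ← map_inner_mixMeasure ha hθ'1, map_measureReal_apply hm hA,
    map_measureReal_apply hm hA]
  exact (abs_real_cond_sub_real_le _ measurableSet_closedBall _ hB0).trans htail

/-! ### Constants uniform in the dimension -/

lemma exists_pos_forall_lt_of_forall_exists_pos {P : ℕ → ℝ → Prop}
    (hP : ∀ n c c', c' ≤ c → P n c → P n c') (h : ∀ n, ∃ c, 0 < c ∧ P n c) (k : ℕ) :
    ∃ c, 0 < c ∧ ∀ n < k, P n c := by
  induction k with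
  | zero => exact ⟨1, one_pos, by simp⟩
  | succ k ih =>
    obtain ⟨c, hc, hck⟩ := ih
    obtain ⟨c', hc', hk⟩ := h k
    refine ⟨min c c', lt_min hc hc', fun n hn => ?_⟩
    rcases Nat.lt_succ_iff_lt_or_eq.1 hn with h | rfl
    · exact hP _ _ _ (min_le_left _ _) (hck n h)
    · exact hP _ _ _ (min_le_right _ _) hk

lemma exp_neg_natCast_le (n : ℕ) (hn : 1 ≤ n) : Real.exp (-n) ≤ 1 / √(n : ℝ) := by
  have hn' : (1 : ℝ) ≤ n := by exact_mod_cast hn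
  rw [Real.exp_neg, ← one_div]
  apply one_div_le_one_div_of_le (by positivity)
  have h1 : √(n : ℝ) ≤ n := Real.sqrt_le_iff.2 ⟨by linarith, by nlinarith⟩
  linarith [Real.add_one_le_exp (n : ℝ)]

lemma real_map_abs_Iic (μ : Measure ℝ) (t : ℝ) :
    (μ.map fun x => |x|).real (Set.Iic t) = μ.real {x | |x| ≤ t} :=
  map_measureReal_apply (by fun_prop) measurableSet_Iic

lemma exists_bodies_far_from_gaussian :
    ∃ c : ℝ, 0 < c ∧ ∃ C : ℝ, 0 < C ∧ ∀ n : ℕ, 1 ≤ n →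
      ∃ K : Set (EuclideanSpace ℝ (Fin (ambientDim n))), IsPConvexBody (1 / 2) K ∧
      ∃ E : Submodule ℝ (EuclideanSpace ℝ (Fin (ambientDim n))), Module.finrank ℝ E = n ∧
      ∀ θ ∈ E, ‖θ‖ = 1 →
        (∀ t : ℝ, |(marginalLaw K E θ).real {x | |x| ≤ t} -
            absGaussianMulUniformLaw.real (Set.Iic t)| ≤ C / √(n : ℝ)) ∧
        ∀ (m : ℝ) (v : ℝ≥0), ¬ LevyClose c (marginalLaw K E θ) (gaussianReal m v) := by
  have ha : 0 < √(3 / 7 : ℝ) := by positivity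
  have hν := isProbabilityMeasure_gaussianMulUniform ha
  obtain ⟨c₀, hc₀, hgap₀⟩ := exists_forall_not_levyClose_gaussianReal
    (map_neg_gaussianMulUniform ha) (gaussianMulUniform_ne_gaussianReal ha)
  -- Beyond k, the error e^(-n) consumes at most half of the gap c₀ of the limiting mixture.
  obtain ⟨k, hk⟩ : ∃ k : ℕ, ∀ n ≥ k, Real.exp (-(n : ℝ)) < c₀ / 2 := by
    have : Tendsto (fun n : ℕ => Real.exp (-(n : ℝ))) atTop (𝓝 0) :=
      Real.tendsto_exp_neg_atTop_nhds_zero.comp tendsto_natCast_atTop_atTop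
    exact eventually_atTop.1 (this.eventually (gt_mem_nhds (half_pos hc₀)))
  set n₀ := max k 16 with hn₀
  obtain ⟨c₁, hc₁, hgap₁⟩ := exists_pos_forall_lt_of_forall_exists_pos
    (P := fun n c => ∀ (E : Submodule ℝ (EuclideanSpace ℝ (Fin (ambientDim n)))), ∀ θ ∈ E,
      ‖θ‖ = 1 → ∀ (m : ℝ) (v : ℝ≥0),
        ¬ LevyClose c (marginalLaw (Metric.closedBall 0 1) E θ) (gaussianReal m v))
    (fun n c c' hcc h E θ hθE hθ m v hcl => by
      have := (isPConvexBody_closedBall (ambientDim n)).isProbabilityMeasure_marginalLaw E θ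
      exact h E θ hθE hθ m v (hcl.mono hcc))
    (fun n => exists_gap_marginalLaw_closedBall (ambientDim n)) n₀
  -- For n < n₀ this C gives C/√n ≥ 1, so the comparison with |G| W is trivial there.
  refine ⟨min (c₀ / 2) c₁, lt_min (half_pos hc₀) hc₁, √(n₀ : ℝ) + 1, by positivity,
    fun n hn => ?_⟩
  have hn0 : (0 : ℝ) < n := by exact_mod_cast hn
  rcases lt_or_ge n n₀ with hlt | hge
  · obtain ⟨E, hE⟩ := exists_submodule_finrank_eq (N := ambientDim n) (Nat.le_add_right n _)
    have hK := isPConvexBody_closedBall (ambientDim n)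
    refine ⟨Metric.closedBall 0 1, hK, E, hE, fun θ hθE hθ => ⟨fun t => ?_, fun m v hcl => ?_⟩⟩
    · have hp := hK.isProbabilityMeasure_marginalLaw E θ
      have hp' : IsProbabilityMeasure absGaussianMulUniformLaw := by
        rw [absGaussianMulUniformLaw_eq_map_abs]
        exact Measure.isProbabilityMeasure_map (by fun_prop)
      have h1 : 1 ≤ (√(n₀ : ℝ) + 1) / √(n : ℝ) := by
        rw [one_le_div (by positivity)]
        have : √(n : ℝ) ≤ √(n₀ : ℝ) := Real.sqrt_le_sqrt (by exact_mod_cast hlt.le)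
        linarith
      refine le_trans (abs_le.2 ⟨?_, ?_⟩) h1
      · linarith [measureReal_nonneg (μ := marginalLaw (Metric.closedBall 0 1) E θ)
          (s := {x | |x| ≤ t}), measureReal_le_one (μ := absGaussianMulUniformLaw) (s := Set.Iic t)]
      · linarith [measureReal_le_one (μ := marginalLaw (Metric.closedBall 0 1) E θ)
          (s := {x | |x| ≤ t}), measureReal_nonneg (μ := absGaussianMulUniformLaw) (s := Set.Iic t)]
    · have := hK.isProbabilityMeasure_marginalLaw E θ
      exact hgap₁ n hlt E θ hθE hθ m v (hcl.mono (min_le_right _ _))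
  · obtain ⟨K, hK, E, hE, h⟩ := exists_isPConvexBody_marginal_close ha
      (N := ambientDim n) hn (le_ambientDim ((le_max_right k 16).trans hge))
    refine ⟨K, hK, E, hE, fun θ hθE hθ => ⟨fun t => ?_, fun m v hcl => ?_⟩⟩
    · rw [absGaussianMulUniformLaw_eq_map_abs, real_map_abs_Iic]
      refine (h θ hθE hθ _ (measurableSet_le (by fun_prop) (by fun_prop))).trans
        ((exp_neg_natCast_le n hn).trans ?_)
      gcongr
      linarith [Real.sqrt_nonneg (n₀ : ℝ)]
    · have hp : IsProbabilityMeasure (marginalLaw K E θ) :=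
        IsPConvexBody.isProbabilityMeasure_marginalLaw (N := n + _) hK E θ
      have hcl' := (hcl.mono (min_le_left _ _)).of_real_Iic_close (half_pos hc₀).le
        fun t => (h θ hθE hθ (Set.Iic t) measurableSet_Iic).trans
          (hk n ((le_max_left k 16).trans hge)).le
      rw [add_halves] at hcl'
      exact hgap₀ m v hcl'
theorem theorem1p2 :
    (∃ c : ℝ, 0 < c ∧ ∃ C : ℝ, 0 < C ∧ ∀ n : ℕ, 1 ≤ n →
      ∃ K : Set (EuclideanSpace ℝ (Fin (ambientDim n))), IsPConvexBody (1 / 2) K ∧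
      ∃ E : Submodule ℝ (EuclideanSpace ℝ (Fin (ambientDim n))), Module.finrank ℝ E = n ∧
      ∀ θ ∈ E, ‖θ‖ = 1 →
        -- the law of `|θ · Proj_E X|` is close to the law of `|G| W`
        (∀ t : ℝ, ∃ s : ℝ, |s - 1| ≤ C * (n : ℝ) ^ (-(1 / 2) + 1 / 100 : ℝ) ∧
          |(marginalLaw K E θ).real {x | |x| ≤ t} -
            absGaussianMulUniformLaw.real (Set.Iic (t * s))| ≤ C / √(n : ℝ)) ∧
        -- and `θ · Proj_E X` is far from every Gaussian
        ∀ (m : ℝ) (v : ℝ≥0),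
          c ≤ kolmogorovDist (marginalLaw K E θ) (gaussianReal m v) ∧
          ENNReal.ofReal c ≤ wassersteinDist (marginalLaw K E θ) (gaussianReal m v) ∧
          ENNReal.ofReal c ≤ levyProkhorovEDist (marginalLaw K E θ) (gaussianReal m v)) ∧
    -- no central limit theorem for marginals of `1/2`-convex bodies
    ¬ ∃ ε : ℕ → ℝ, Tendsto ε atTop (𝓝 0) ∧ ∀ n : ℕ, 1 ≤ n →
      ∀ (M : ℕ) (K : Set (EuclideanSpace ℝ (Fin M))), IsPConvexBody (1 / 2) K →
      ∀ E : Submodule ℝ (EuclideanSpace ℝ (Fin M)), Module.finrank ℝ E = n →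
      ∃ θ ∈ E, ‖θ‖ = 1 ∧ ∃ (m : ℝ) (v : ℝ≥0),
        kolmogorovDist (marginalLaw K E θ) (gaussianReal m v) ≤ ε n := by

  obtain ⟨c, hc, C, hC, hmain⟩ := exists_bodies_far_from_gaussian
  have hc1 : 0 < min c 1 := lt_min hc one_pos
  have hfar : ∀ n : ℕ, 1 ≤ n →
      ∃ K : Set (EuclideanSpace ℝ (Fin (ambientDim n))), IsPConvexBody (1 / 2) K ∧
      ∃ E : Submodule ℝ (EuclideanSpace ℝ (Fin (ambientDim n))), Module.finrank ℝ E = n ∧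
      ∀ θ ∈ E, ‖θ‖ = 1 →
        (∀ t : ℝ, ∃ s : ℝ, |s - 1| ≤ C * (n : ℝ) ^ (-(1 / 2) + 1 / 100 : ℝ) ∧
          |(marginalLaw K E θ).real {x | |x| ≤ t} -
            absGaussianMulUniformLaw.real (Set.Iic (t * s))| ≤ C / √(n : ℝ)) ∧
        ∀ (m : ℝ) (v : ℝ≥0),
          min c 1 ^ 2 ≤ kolmogorovDist (marginalLaw K E θ) (gaussianReal m v) ∧
          ENNReal.ofReal (min c 1 ^ 2) ≤
            wassersteinDist (marginalLaw K E θ) (gaussianReal m v) ∧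
          ENNReal.ofReal (min c 1 ^ 2) ≤
            levyProkhorovEDist (marginalLaw K E θ) (gaussianReal m v) := by
    intro n hn
    obtain ⟨K, hK, E, hE, h⟩ := hmain n hn
    -- No dilation is needed: s = 1 works for every t.
    refine ⟨K, hK, E, hE, fun θ hθE hθ => ⟨fun t => ⟨1, ?_, ?_⟩, fun m v => ?_⟩⟩
    · rw [sub_self, abs_zero]; positivity
    · rw [mul_one]; exact (h θ hθE hθ).1 t
    · have := hK.isProbabilityMeasure_marginalLaw E θ
      exact gaussianReal_gap_of_not_levyClose hc1 (min_le_right _ _)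
        fun hcl => (h θ hθE hθ).2 m v (hcl.mono (min_le_left _ _))
  refine ⟨⟨min c 1 ^ 2, by positivity, C, hC, hfar⟩, ?_⟩
  rintro ⟨ε, hε, hclt⟩
  obtain ⟨n, hεn, hn⟩ := ((hε.eventually (gt_mem_nhds (pow_pos hc1 2))).and
    (eventually_ge_atTop 1)).exists
  obtain ⟨K, hK, E, hE, h⟩ := hfar n hn
  obtain ⟨θ, hθE, hθ, m, v, hle⟩ := hclt n hn _ K hK E hE
  linarith [((h θ hθE hθ).2 m v).1]
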